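/- **Lemma (polynomial proof complexity).** Let $M=(Q,\Gamma,\delta,q_0,q_{halt})$ be a one-tape Turing machine with a finite state set $Q$, tape alphabet $\Gamma=\{0,1,\sqcup,\triangleright\}$, a one-way infinite tape whose square $0$ carries the marker $\triangleright$, and $\delta: Q\times\Gamma\to Q\times\Gamma\times\{L,S,R\}$, such that $\delta(q_{halt},a)=(q_{halt},a,S)$ for all $a$ and $q_{halt}$ is the only state with these transitions; in every state $q\neq q_{halt}$ the machine keeps $\triangleright$ and moves right when it reads $\triangleright$; and $\triangleright$ is never written in place of another symbol. The machine starts in state $q_0$ on square $0$, with the input $s\in\{0,1\}^*$ on squares $1,\dots,\|s\|$ and blanks beyond. Write $M(s)=v$ if $M$ on input $s$ halts reading $v\in\{0,1\}$ on square $1$. Suppose that $M$ computes a function $\{0,1\}^*\to\{0,1\}$, i.e. for every $s$ there is a $v\in\{0,1\}$ with $M(s)=v$, and that the maximal number $t_M(n)$ of steps of $M$ on inputs of length $n$ is bounded by a polynomial in $n$. Consider first-order formulas in the language of set theory with $\in$, the defined symbols $\emptyset$, $\{x,y\}$, $(x,y)$, $x+1=x\cup\{x\}$, $\omega$, $f(x)$,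 and two constants $t$ and $\pi_M$; natural numbers are von Neumann numerals, tape symbols and states are coded by numerals, and $t_{i,j}$ stands for $t(i)(j)$. Let $\mathbf T_{\langle M,s\rangle}$ be the finite list of the following formulas (number variables range over $\omega$): * $t$ is a function on $\omega$ whose values are functions from $\omega$ to $\Gamma\times Q\times\{0,1\}$; $\pi_M$ is the function on $\Gamma\times Q\times\{0,1\}$ with $\pi_M(a,q,c)=a$; * $\forall i\; t_{i,0}\in\{\triangleright\}\times Q\times\{0,1\}$; and $\forall i\,\exists k\,\bigl(t_{i,k}\in\Gamma\times Q\times\{1\}\wedge\forall j\,(j\ne k\to t_{i,j}\in\Gamma\times Q\times\{0\})\bigr)$; * for each $(q,a)\in Q\times\Gamma$ with $\delta(q,a)=(p,b,d)$, the formula saying that for all $i,j$, if $t_{i,j}=(a,q,1)$ and $j'$ is $j-1$, $j$ or $j+1$ according as $d$ is $L$, $S$ or $R$, then row $i+1$ has $b$ on square $j$ and $\pi_M(t_{i,k})$ on every square $k\neq j$, all with state $p$, and third component $1$ on square $j'$ and $0$ on all other squares; * $\exists m\,\bigl(\forall j<m\;t_{0,j}\neq(\sqcup,q_0,0)\wedge\forall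 j\ge m\;t_{0,j}=(\sqcup,q_0,0)\bigr)$; * $\forall j>\|s\|\;\;t_{0,j}=(\sqcup,q_0,0)$; $\;t_{0,0}=(\triangleright,q_0,1)$; and $t_{0,k+1}=(s_k,q_0,0)$ for $0\le k<\|s\|$. A *normal proof* of $M(s)=v$ is a finite sequence of formulas that ends with $\exists i\; t_{i,1}=(v,q_{halt},1)$ and in which every formula is a logical axiom, an axiom of ZFC (including the definitions of the defined symbols, with schemes over the whole language), a member of $\mathbf T_{\langle M,s\rangle}$, or follows from earlier formulas by modus ponens or from an earlier formula by generalization. The logical axioms are: tautologies; $\forall x\,\alpha\to\alpha^x_r$ and $\alpha^x_r\to\exists x\,\alpha$ for $r$ substitutable for $x$ in $\alpha$; $\forall x(\alpha\to\beta)\to(\forall x\,\alpha\to\forall x\,\beta)$; $\alpha\to\forall x\,\alpha$ for $x$ not free in $\alpha$; $x=x$; and $x=y\to(\alpha\to\beta)$ for atomic $\alpha$, where $\beta$ arises from $\alpha$ by replacing one occurrence of $x$ by $y$. The length of a normal proof is the total number of ASCII characters in the LaTeX source of its formulas (logical symbols $=,\neg,\to,\forall$, the others being abbreviations; numerals in decimal).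 Let $\mathbf{FS}(M,s,v)$ be the least length of a normal proof of $M(s)=v$ ($\infty$ if there is none), and let the *adjoint proof complexity* of $M$ be $$\mathbf{apf}_M(n)=\max\{\mathbf{FS}(M,r,v) : \|r\|=n,\ M(r)=v\}.$$ Then $\mathbf{apf}_M$ is bounded by a polynomial: there is a polynomial $P$ with coefficients in $\mathbb N$ such that $\mathbf{apf}_M(n)\le P(n)$ for all $n\in\mathbb N$. In particular, a normal proof of $M(r)=v$ exists whenever $M(r)=v$. -/

import Mathlib

namespace ProofComplexity

/-! ## Turing machines -/

/-- The tape alphabet `{0, 1, ⊔, ▷}`. -/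
inductive Sym
  | zero | one | blank | start

/-- Head moves: left, stay, right. -/
inductive Dir
  | L | S | R

/-- A one-tape Turing machine with states `0, …, card - 1`, tape alphabet `{0, 1, ⊔, ▷}`,
and a one-way infinite tape whose square `0` carries the left end marker `▷`. -/
structure TM where
  card : ℕ
  δ : Fin card → Sym → Fin card × Sym × Dir
  q0 : Fin card
  halt : Fin card
  /-- On `▷` a machine that has not halted keeps the marker and moves right. -/
  start_rule : ∀ q, q ≠ halt → (δ q .start).2 = (.start, .R)
  /-- The marker `▷` is never written on another square. -/
  start_not_written : ∀ q a, a ≠ .start → (δ q a).2.1 ≠ .start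
  halt_rule : ∀ a, δ halt a = (halt, a, .S)
  halt_unique : ∀ q, (∀ a, δ q a = δ halt a) → q = halt

/-- The tape symbol of an input bit. -/
def bitSym : Bool → Sym
  | false => .zero
  | true => .one

/-- Configurations: current state, position of the head, content of the tape. -/
structure Config (M : TM) where
  state : Fin M.card
  head : ℕ
  tape : ℕ → Sym

namespace TM

/-- The start configuration: `▷` on square `0`, the input on squares `1, …, ‖s‖`, blanks
elsewhere, the head on square `0`. -/
def init (M : TM) (s : List Bool) : Config M where
  state := M.q0
  head := 0
  tape
    | 0 => .start
    | k + 1 => (s[k]?).elim .blank bitSym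

def move : Dir → ℕ → ℕ
  | .L, h => h - 1
  | .S, h => h
  | .R, h => h + 1

def step (M : TM) (c : Config M) : Config M where
  state := (M.δ c.state (c.tape c.head)).1
  head := move (M.δ c.state (c.tape c.head)).2.2 c.head
  tape := Function.update c.tape c.head (M.δ c.state (c.tape c.head)).2.1

/-- The configuration after `i` steps on input `s`. -/
def run (M : TM) (s : List Bool) (i : ℕ) : Config M := M.step^[i] (M.init s)

/-- `M(s) = v`: `M` halts on `s`, reading the symbol `v` on square `1`. -/
def Outputs (M : TM) (s : List Bool) (v : Bool) : Prop :=
  ∃ i, (M.run s i).state = M.halt ∧ (M.run s i).head = 1 ∧ (M.run s i).tape 1 = bitSym v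

/-- The number of steps of `M` on input `s` (`⊤` if `M` does not halt on `s`). -/
noncomputable def steps (M : TM) (s : List Bool) : ℕ∞ :=
  ⨅ (i : ℕ) (_ : (M.run s i).state = M.halt), (i : ℕ∞)

/-- The time complexity `t_M(n)`: the maximum number of steps on an input of length `n`. -/
noncomputable def timeComplexity (M : TM) (n : ℕ) : ℕ∞ :=
  ⨆ (s : List Bool) (_ : s.length = n), M.steps s

/-- `M` halts on all inputs, and its time complexity is bounded by a polynomial. -/
def IsPolyTime (M : TM) : Prop :=
  ∃ P : Polynomial ℕ, ∀ n : ℕ, M.timeComplexity n ≤ ((P.eval n : ℕ) : ℕ∞)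

end TM

/-! ## The language of set theory with the usual defined symbols -/

/-- Constant symbols: the table `t`, the projection `π_M`, the empty set and `ω`. -/
inductive Cst
  | tab | proj | empty | omega

/-- Binary function symbols: `{x, y}`, `(x, y)` and the value `f(x)` of a function. -/
inductive Bin
  | upair | pair | app

/-- Terms over the variables `x_0, x_1, …`; `succ x` is `x ∪ {x}`, that is `x + 1` on `ω`. -/
inductive Trm
  | var (k : ℕ)
  | cst (c : Cst)
  | succ (s : Trm)
  | bin (f : Bin) (s u : Trm)

/-- First-order formulas; the primitive logical symbols are `=`, `¬`, `→`, `∀`. -/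
inductive Frm
  | eq (s u : Trm)
  | mem (s u : Trm)
  | neg (φ : Frm)
  | imp (φ ψ : Frm)
  | all (k : ℕ) (φ : Frm)

namespace Trm

abbrev tab : Trm := cst .tab
abbrev proj : Trm := cst .proj
abbrev empty : Trm := cst .empty
abbrev omega : Trm := cst .omega
abbrev upair (s u : Trm) : Trm := bin .upair s u
abbrev pair (s u : Trm) : Trm := bin .pair s u
abbrev app (s u : Trm) : Trm := bin .app s u

/-- The von Neumann numeral `n`. -/
def num : ℕ → Trm
  | 0 => empty
  | n + 1 => succ (num n)

/-- The variable `x_x` occurs in a term. -/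
def Occurs (x : ℕ) : Trm → Prop
  | var k => k = x
  | cst _ => False
  | succ s => s.Occurs x
  | bin _ s u => s.Occurs x ∨ u.Occurs x

/-- `s.subst x r`: replacing the variable `x_x` in `s` by the term `r`. -/
def subst (s : Trm) (x : ℕ) (r : Trm) : Trm :=
  match s with
  | var k => if k = x then r else var k
  | cst c => cst c
  | succ s => succ (s.subst x r)
  | bin f s u => bin f (s.subst x r) (u.subst x r)

/-- The second term arises from the first by replacing one occurrence of `x_x` by `x_y`. -/
inductive Repl (x y : ℕ) : Trm → Trm → Prop
  | here : Repl x y (var x) (var y)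
  | succ {s s₁ : Trm} : Repl x y s s₁ → Repl x y (succ s) (succ s₁)
  | left {f : Bin} {s s₁ u : Trm} : Repl x y s s₁ → Repl x y (bin f s u) (bin f s₁ u)
  | right {f : Bin} {s u u₁ : Trm} : Repl x y u u₁ → Repl x y (bin f s u) (bin f s u₁)

end Trm

namespace Frm

def and (φ ψ : Frm) : Frm := neg (imp φ (neg ψ))
def or (φ ψ : Frm) : Frm := imp (neg φ) ψ
def iff (φ ψ : Frm) : Frm := and (imp φ ψ) (imp ψ φ)
def ex (k : ℕ) (φ : Frm) : Frm := neg (all k (neg φ))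
def ne (s u : Trm) : Frm := neg (eq s u)

/-- `∀ x_k ∈ A, φ` -/
def allIn (k : ℕ) (A : Trm) (φ : Frm) : Frm := all k (imp (mem (.var k) A) φ)
/-- `∃ x_k ∈ A, φ` -/
def exIn (k : ℕ) (A : Trm) (φ : Frm) : Frm := ex k (and (mem (.var k) A) φ)

/-- The variable `x_x` occurs free in a formula. -/
def Free (x : ℕ) : Frm → Prop
  | eq s u => s.Occurs x ∨ u.Occurs x
  | mem s u => s.Occurs x ∨ u.Occurs x
  | neg φ => φ.Free x
  | imp φ ψ => φ.Free x ∨ ψ.Free x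
  | all k φ => k ≠ x ∧ φ.Free x

/-- Replacing the free occurrences of `x_x` by the term `r`. -/
def subst (x : ℕ) (r : Trm) : Frm → Frm
  | eq s u => eq (s.subst x r) (u.subst x r)
  | mem s u => mem (s.subst x r) (u.subst x r)
  | neg φ => neg (φ.subst x r)
  | imp φ ψ => imp (φ.subst x r) (ψ.subst x r)
  | all k φ => if k = x then all k φ else all k (φ.subst x r)

/-- The term `r` is substitutable for `x_x` in a formula. -/
def Substitutable (x : ℕ) (r : Trm) : Frm → Prop
  | eq _ _ => True
  | mem _ _ => True
  | neg φ => φ.Substitutable x r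
  | imp φ ψ => φ.Substitutable x r ∧ ψ.Substitutable x r
  | all k φ => ¬ (all k φ).Free x ∨ (¬ r.Occurs k ∧ φ.Substitutable x r)

/-- Tautologies: true under every truth assignment, where atomic and universally quantified
formulas count as propositional letters. -/
def Tautology (φ : Frm) : Prop :=
  ∀ V : Frm → Prop, (∀ α, V (neg α) ↔ ¬ V α) → (∀ α β, V (imp α β) ↔ (V α → V β)) → V φ

/-- Both formulas are atomic, and the second arises from the first by replacing one occurrence
of `x_x` by `x_y`. -/
inductive AtomRepl (x y : ℕ) : Frm → Frm → Prop
  | eq_left {s s₁ u : Trm} : Trm.Repl x y s s₁ → AtomRepl x y (eq s u) (eq s₁ u)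
  | eq_right {s u u₁ : Trm} : Trm.Repl x y u u₁ → AtomRepl x y (eq s u) (eq s u₁)
  | mem_left {s s₁ u : Trm} : Trm.Repl x y s s₁ → AtomRepl x y (mem s u) (mem s₁ u)
  | mem_right {s u u₁ : Trm} : Trm.Repl x y u u₁ → AtomRepl x y (mem s u) (mem s u₁)

end Frm

/-! ## Lengths: formulas as LaTeX source in ASCII -/

/-- ASCII strings, as lists of character codes. -/
abbrev Ascii := List (Fin 128)

/-- The decimal representation of a natural number. -/
def decimal (n : ℕ) : Ascii :=
  if n = 0 then [48] else ((Nat.digits 10 n).map fun d => Fin.ofNat 128 (48 + d)).reverse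

/-- `x_{k}` -/
def varTex (k : ℕ) : Ascii := [120, 95, 123] ++ decimal k ++ [125]

/-- `t`, `\pi_{M}`, `0`, `\omega` -/
def Cst.tex : Cst → Ascii
  | .tab => [116]
  | .proj => [92, 112, 105, 95, 123, 77, 125]
  | .empty => [48]
  | .omega => [92, 111, 109, 101, 103, 97]

/-- `\{x,y\}`, `(x,y)`, `f(x)` -/
def Bin.tex : Bin → Ascii → Ascii → Ascii
  | .upair, a, b => [92, 123] ++ a ++ [44] ++ b ++ [92, 125]
  | .pair, a, b => [40] ++ a ++ [44] ++ b ++ [41]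
  | .app, a, b => a ++ [40] ++ b ++ [41]

/-- The value of a term that is a numeral. -/
def Trm.numVal : Trm → Option ℕ
  | .cst .empty => some 0
  | .succ s => s.numVal.map (· + 1)
  | _ => none

/-- The LaTeX source of a term; numerals are written in decimal, other successors as `(s+1)`. -/
def Trm.tex : Trm → Ascii
  | .var k => varTex k
  | .cst c => c.tex
  | .succ s => s.numVal.elim ([40] ++ s.tex ++ [43, 49, 41]) fun n => decimal (n + 1)
  | .bin f s u => f.tex s.tex u.tex

/-- The LaTeX source of a formula: `s=u`, `s\in u`, `\neg φ`, `(φ\rightarrow ψ)`,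
`\forall x_{k}φ`. -/
def Frm.tex : Frm → Ascii
  | .eq s u => s.tex ++ [61] ++ u.tex
  | .mem s u => s.tex ++ [92, 105, 110, 32] ++ u.tex
  | .neg φ => [92, 110, 101, 103, 32] ++ φ.tex
  | .imp φ ψ =>
      [40] ++ φ.tex ++ [92, 114, 105, 103, 104, 116, 97, 114, 114, 111, 119, 32] ++ ψ.tex ++ [41]
  | .all k φ => [92, 102, 111, 114, 97, 108, 108, 32] ++ varTex k ++ φ.tex

/-- The ASCII length of a formula, written between two dollar signs. -/
def Frm.asciilen (φ : Frm) : ℕ := ([36] ++ φ.tex ++ [36] : Ascii).length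

/-- The ASCII length of a sequence of formulas. -/
def seqLen (π : List Frm) : ℕ := (π.map Frm.asciilen).sum

/-! ## Logical axioms, ZFC, proofs -/

open ProofComplexity.Frm ProofComplexity.Trm

/-- The logical axioms. -/
inductive LogicalAxiom : Frm → Prop
  | taut {φ : Frm} : φ.Tautology → LogicalAxiom φ
  | inst {x : ℕ} {r : Trm} {α : Frm} : α.Substitutable x r →
      LogicalAxiom (imp (all x α) (α.subst x r))
  | distrib {x : ℕ} {α β : Frm} :
      LogicalAxiom (imp (all x (imp α β)) (imp (all x α) (all x β)))
  | vacuous {x : ℕ} {α : Frm} : ¬ α.Free x → LogicalAxiom (imp α (all x α))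
  | refl {x : ℕ} : LogicalAxiom (eq (var x) (var x))
  | leibniz {x y : ℕ} {α β : Frm} : AtomRepl x y α β →
      LogicalAxiom (imp (eq (var x) (var y)) (imp α β))
  | exIntro {x : ℕ} {r : Trm} {α : Frm} : α.Substitutable x r →
      LogicalAxiom (imp (α.subst x r) (ex x α))

/-- The formula `∅ ∈ y ∧ ∀ z ∈ y, z + 1 ∈ y`, with bound variable `x_9`. -/
def inductiveSet (y : Trm) : Frm :=
  and (mem empty y) (allIn 9 y (mem (succ (var 9)) y))

/-- `∀ w, (x, w) ∈ f ↔ w = y`: the set `y` is the only one with `(x, y) ∈ f`. The bound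
variable is `x_9`. -/
def onlyValue (f x y : Trm) : Frm :=
  all 9 (iff (mem (pair x (var 9)) f) (eq (var 9) y))

/-- ZFC, extended by the definitions of `∅`, `{x, y}`, `x + 1`, `(x, y)`, `ω` and `f(x)`.
The scheme instances may have free variables, which act as parameters. -/
inductive ZFC : Frm → Prop
  | extensionality :
      ZFC (all 0 (all 1 (imp (all 2 (iff (mem (var 2) (var 0)) (mem (var 2) (var 1))))
        (eq (var 0) (var 1)))))
  | foundation :
      ZFC (all 0 (imp (ex 1 (mem (var 1) (var 0)))
        (exIn 1 (var 0) (neg (exIn 2 (var 0) (mem (var 2) (var 1)))))))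
  | pairing : ZFC (all 0 (all 1 (ex 2 (and (mem (var 0) (var 2)) (mem (var 1) (var 2))))))
  | union :
      ZFC (all 0 (ex 1 (allIn 2 (var 0) (allIn 3 (var 2) (mem (var 3) (var 1))))))
  | powerset :
      ZFC (all 0 (ex 1 (all 2 (imp (allIn 3 (var 2) (mem (var 3) (var 0)))
        (mem (var 2) (var 1))))))
  | infinity : ZFC (ex 0 (inductiveSet (var 0)))
  | separation {a b x : ℕ} {φ : Frm} : a ≠ b → a ≠ x → b ≠ x → ¬ φ.Free b →
      ZFC (all a (ex b (all x (iff (mem (var x) (var b)) (and (mem (var x) (var a)) φ)))))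
  | replacement {a b x y z : ℕ} {φ : Frm} : [a, b, x, y, z].Nodup → ¬ φ.Free b → ¬ φ.Free z →
      ZFC (all a (imp (allIn x (var a) (ex z (all y (iff φ (eq (var y) (var z))))))
        (ex b (allIn x (var a) (exIn y (var b) φ)))))
  | choice :
      ZFC (all 0 (imp
        (and (allIn 1 (var 0) (ex 2 (mem (var 2) (var 1))))
          (allIn 1 (var 0) (allIn 2 (var 0) (imp (ne (var 1) (var 2))
            (neg (exIn 3 (var 1) (mem (var 3) (var 2))))))))
        (ex 4 (allIn 1 (var 0) (ex 2 (all 3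
          (iff (and (mem (var 3) (var 1)) (mem (var 3) (var 4))) (eq (var 3) (var 2)))))))))
  | def_empty : ZFC (all 0 (neg (mem (var 0) empty)))
  | def_upair :
      ZFC (all 0 (all 1 (all 2 (iff (mem (var 2) (upair (var 0) (var 1)))
        (or (eq (var 2) (var 0)) (eq (var 2) (var 1)))))))
  | def_succ :
      ZFC (all 0 (all 1 (iff (mem (var 1) (succ (var 0)))
        (or (mem (var 1) (var 0)) (eq (var 1) (var 0))))))
  | def_pair :
      ZFC (all 0 (all 1 (eq (pair (var 0) (var 1))
        (upair (upair (var 0) (var 0)) (upair (var 0) (var 1))))))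
  /- `ω` is the least inductive set -/
  | def_omega :
      ZFC (all 0 (iff (mem (var 0) omega)
        (all 1 (imp (inductiveSet (var 1)) (mem (var 0) (var 1))))))
  /- `f(x)` is the only `y` with `(x, y) ∈ f`, and `∅` if there is no such `y` -/
  | def_app :
      ZFC (all 0 (all 1 (all 2 (iff (eq (app (var 0) (var 1)) (var 2))
        (or (onlyValue (var 0) (var 1) (var 2))
          (and (neg (ex 3 (onlyValue (var 0) (var 1) (var 3)))) (eq (var 2) empty)))))))

/-- `π` is a proof of `φ` from `T` in ZFC. -/
def IsProof (T : List Frm) (π : List Frm) (φ : Frm) : Prop :=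
  π.getLast? = some φ ∧
  ∀ i : Fin π.length,
    LogicalAxiom π[i] ∨ ZFC π[i] ∨ π[i] ∈ T ∨
    (∃ j k : Fin π.length, j < i ∧ k < i ∧ π[j] = imp π[k] π[i]) ∨
    (∃ j : Fin π.length, j < i ∧ ∃ k : ℕ, π[i] = all k π[j])

/-! ## The formulas that describe the computation of a machine on an input -/

/-- Tape symbols are coded by the numerals `0, 1, 2, 3`. -/
def Sym.code : Sym → Trm
  | .zero => num 0
  | .one => num 1
  | .blank => num 2
  | .start => num 3

/-- `t_{i,j}`, that is `t(i)(j)` -/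
def cell (i j : Trm) : Trm := app (app tab i) j

/-- The tape square `(a, q, c)`: symbol, state, and whether the head is there. -/
def square (a q c : Trm) : Trm := pair (pair a q) c

/-- The symbol `π_M(z)` of the tape square `z`. -/
def projOf (z : Trm) : Trm := app proj z

/-- `z ∈ A × B × C`, with bound variables `x_10, x_11, x_12`. -/
def inProd (z A B C : Trm) : Frm :=
  exIn 10 A (exIn 11 B (exIn 12 C (eq z (square (var 10) (var 11) (var 12)))))

/-- `f` is a function whose domain is the class `dom`; bound variables `x_20, …, x_22, x_9`. -/
def isFun (f : Trm) (dom : Trm → Frm) : Frm :=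
  and
    (all 20 (imp (mem (var 20) f)
      (ex 21 (ex 22 (and (dom (var 21)) (eq (var 20) (pair (var 21) (var 22))))))))
    (all 21 (imp (dom (var 21)) (ex 22 (onlyValue f (var 21) (var 22)))))

/-- The singleton `{x}`. -/
def sing (x : Trm) : Trm := upair x x

namespace TM

/-- The set `Γ = {0, 1, 2, 3}` of (codes of) tape symbols. -/
def gammaSet : Trm := num 4

/-- The set `{0, 1}`. -/
def bitSet : Trm := num 2

variable (M : TM)

/-- The set `Q = {0, …, card - 1}` of (codes of) states. -/
def stateSet : Trm := num M.card

/-- The code of a state. -/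
def stateCode (q : Fin M.card) : Trm := num q

/-- `t ∈ Table_M`: `t` is a function on `ω`, every `t(i)` is a function on `ω`, and every
`t_{i,j}` is in `Γ × Q × {0, 1}`. -/
def tableFormulas : List Frm :=
  [ isFun tab (fun x => mem x omega),
    allIn 0 omega (isFun (app tab (var 0)) (fun x => mem x omega)),
    allIn 0 omega (allIn 1 omega (inProd (cell (var 0) (var 1)) gammaSet M.stateSet bitSet)) ]

/-- `π_M` is the function on `Γ × Q × {0, 1}` with `π_M(s, p, v) = s`. -/
def projFormulas : List Frm :=
  [ isFun proj (fun x => inProd x gammaSet M.stateSet bitSet),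
    allIn 0 gammaSet (allIn 1 M.stateSet (allIn 2 bitSet
      (eq (projOf (square (var 0) (var 1) (var 2))) (var 0)))) ]

/-- `∀ i, t_{i,0} ∈ {▷} × Q × {0, 1}` -/
def leftEndFormula : Frm :=
  allIn 0 omega (inProd (cell (var 0) (num 0)) (sing Sym.start.code) M.stateSet bitSet)

/-- `∀ i ∃ k, t_{i,k} ∈ Γ × Q × {1} ∧ ∀ j, j ≠ k → t_{i,j} ∈ Γ × Q × {0}` -/
def oneHeadFormula : Frm :=
  allIn 0 omega (exIn 2 omega (and
    (inProd (cell (var 0) (var 2)) gammaSet M.stateSet (sing (num 1)))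
    (allIn 1 omega (imp (ne (var 1) (var 2))
      (inProd (cell (var 0) (var 1)) gammaSet M.stateSet (sing (num 0)))))))

/-- Square `k` of row `i + 1` is `(π_M(t_{i,k}), p, c)`; here `i` is `x_0`. -/
def copied (k : Trm) (p : Fin M.card) (c : ℕ) : Frm :=
  eq (cell (succ (var 0)) k) (square (projOf (cell (var 0) k)) (M.stateCode p) (num c))

/-- The formula of the transition `δ(q, a) = (p, b, d)`; the variables `x_0, x_1, x_2` are
`i, j, k`. For a move to the left the head is on square `j + 1` and moves to square `j`:
such a move is never made from square `0`. -/
def transitionFormula (q : Fin M.card) (a : Sym) : Fin M.card × Sym × Dir → Frm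
  | (p, b, .L) =>
      allIn 0 omega (allIn 1 omega (imp
        (eq (cell (var 0) (succ (var 1))) (square a.code (M.stateCode q) (num 1)))
        (and (eq (cell (succ (var 0)) (succ (var 1))) (square b.code (M.stateCode p) (num 0)))
          (and (M.copied (var 1) p 1)
            (allIn 2 omega (imp (and (ne (var 2) (succ (var 1))) (ne (var 2) (var 1)))
              (M.copied (var 2) p 0)))))))
  | (p, b, .S) =>
      allIn 0 omega (allIn 1 omega (imp
        (eq (cell (var 0) (var 1)) (square a.code (M.stateCode q) (num 1)))
        (and (eq (cell (succ (var 0)) (var 1)) (square b.code (M.stateCode p) (num 1)))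
          (allIn 2 omega (imp (ne (var 2) (var 1)) (M.copied (var 2) p 0))))))
  | (p, b, .R) =>
      allIn 0 omega (allIn 1 omega (imp
        (eq (cell (var 0) (var 1)) (square a.code (M.stateCode q) (num 1)))
        (and (eq (cell (succ (var 0)) (var 1)) (square b.code (M.stateCode p) (num 0)))
          (and (M.copied (succ (var 1)) p 1)
            (allIn 2 omega (imp (and (ne (var 2) (var 1)) (ne (var 2) (succ (var 1))))
              (M.copied (var 2) p 0)))))))

/-- One formula for each pair of a state and a tape symbol. -/
def transitionFormulas : List Frm :=
  (List.finRange M.card).flatMap fun q =>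
    [Sym.zero, Sym.one, Sym.blank, Sym.start].map fun a => M.transitionFormula q a (M.δ q a)

/-- The square `(⊔, q_0, 0)`. -/
def blankSquare : Trm := square Sym.blank.code (M.stateCode M.q0) (num 0)

/-- `∃ m, (∀ j < m, t_{0,j} ≠ (⊔, q_0, 0)) ∧ (∀ j ≥ m, t_{0,j} = (⊔, q_0, 0))`, where `j < m`
on `ω` is `j ∈ m`. -/
def startRowFormula : Frm :=
  exIn 3 omega (and
    (allIn 1 omega (imp (mem (var 1) (var 3)) (ne (cell (num 0) (var 1)) M.blankSquare)))
    (allIn 1 omega (imp (neg (mem (var 1) (var 3))) (eq (cell (num 0) (var 1)) M.blankSquare))))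

/-- The formulas `def_M`, which depend on the machine only. -/
def defFormulas : List Frm :=
  M.tableFormulas ++ M.projFormulas ++ [M.leftEndFormula, M.oneHeadFormula] ++
    M.transitionFormulas ++ [M.startRowFormula]

/-- The formulas `input_s`: `∀ j > ‖s‖, t_{0,j} = (⊔, q_0, 0)`, then
`t_{0,0} = (▷, q_0, 1)`, then one formula for each bit of `s`. -/
def inputFormulas (s : List Bool) : List Frm :=
  [ allIn 1 omega (imp (mem (num s.length) (var 1)) (eq (cell (num 0) (var 1)) M.blankSquare)),
    eq (cell (num 0) (num 0)) (square Sym.start.code (M.stateCode M.q0) (num 1)) ] ++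
  (List.finRange s.length).map fun k : Fin s.length =>
    eq (cell (num 0) (num (k.val + 1))) (square (bitSym (s.get k)).code (M.stateCode M.q0) (num 0))

/-- The formulas `T_{⟨M,s⟩}`. -/
def theory (s : List Bool) : List Frm := M.defFormulas ++ M.inputFormulas s

/-- `∃ i, t_{i,1} = (v, q_halt, 1)` -/
def goal (v : Bool) : Frm :=
  exIn 0 omega (eq (cell (var 0) (num 1)) (square (bitSym v).code (M.stateCode M.halt) (num 1)))

/-- `π` is a normal proof of `M(s) = v`. -/
def IsNormalProof (s : List Bool) (v : Bool) (π : List Frm) : Prop :=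
  IsProof (M.theory s) π (M.goal v)

/-- `FS(M, s, v)`: the shortest length of a normal proof of `M(s) = v` (`⊤` if there is none). -/
noncomputable def FS (s : List Bool) (v : Bool) : ℕ∞ :=
  ⨅ (π : List Frm) (_ : M.IsNormalProof s v π), (seqLen π : ℕ∞)

/-- The adjoint proof complexity `apf_M(n)`: the maximum of `FS(M, r, v)` over all inputs `r`
of length `n`, where `v` is the value `M(r)`. -/
noncomputable def apf (n : ℕ) : ℕ∞ :=
  ⨆ (r : List Bool) (_ : r.length = n) (v : Bool) (_ : M.Outputs r v), M.FS r v

end TM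

end ProofComplexity

namespace ProofComplexity

/-! ## Sizes of terms and formulas -/

/-! The formal proof follows the computation. If `M` reaches its output on `s` after `f` steps, with
`f` polynomial in the length of `s`, then the head stays on squares up to `f`, so it suffices to
derive rows `0, …, f` of the table on the squares below `f + 2`. For each such square a formula
`rowFrm` records its symbol, the state and the head bit. Row `0` comes from the input formulas
(`proves_rowFrm_init`). A square of row `j + 1` follows from at most two squares of row `j`, the one
with the same index and the head square, by one transition formula and an evaluation of `π_M`
(`Proves.rowFrm_step`). Square `1` of the last row is a witness for the existential goal
(`Family.proves_goal`).

Two facts keep this polynomial. First, the rows are accumulated in one sequence and reused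
(`Seq.cut`, `proves_of_rows`), so the costs add up; deriving every square separately from its two
predecessors could double the cost at each step. Second, the set theory needed concerns only
numerals of polynomial value: `n ∈ ω`, `m ∈ n` for `m < n`, and `m ≠ n`. The first two are reached
by walking up the numerals; the last reduces to `n ∉ n`, an instance of Foundation
(`proves_num_not_mem_self`).

Uniformity is handled by `Family.Proves`: one polynomial bounds the proofs of all members of an
indexed family. Since this notion is closed under the rules of inference, case distinctions and
induction along rows, hardly any polynomial has to be written down. Length is replaced by a crude
size in which numerals count in unary, which is harmless because all numerals that occur have
polynomially bounded value. -/

/-- The size of a term, an upper bound for the length of its LaTeX source. -/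
def Trm.sz : Trm → ℕ
  | .var k => k + 10
  | .cst _ => 10
  | .succ s => s.sz + 10
  | .bin _ s u => s.sz + u.sz + 10

/-- The size of a formula, an upper bound for its ASCII length. -/
def Frm.sz : Frm → ℕ
  | .eq s u => s.sz + u.sz + 10
  | .mem s u => s.sz + u.sz + 10
  | .neg φ => φ.sz + 10
  | .imp φ ψ => φ.sz + ψ.sz + 20
  | .all k φ => k + φ.sz + 20

/-- A linear bound is enough: the size charges for indices and numerals in unary anyway. -/
theorem length_decimal_le (n : ℕ) : (decimal n).length ≤ n + 1 := by
  unfold decimal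
  split_ifs with h
  · simp
  · have := Nat.log_lt_self 10 h
    simp only [List.length_reverse, List.length_map, Nat.length_digits 10 n (by norm_num) h]
    omega

theorem length_varTex_le (k : ℕ) : (varTex k).length ≤ k + 5 := by
  have := length_decimal_le k
  simp [varTex]
  omega

/-- Every successor adds 10 to the size, so the size of a numeral dominates its value and hence its
decimal representation. -/
theorem Trm.numVal_le_sz {s : Trm} {n : ℕ} (h : s.numVal = some n) : n + 10 ≤ s.sz := by
  induction s generalizing n with
  | var k => simp [numVal] at h
  | bin f s u _ _ => simp [numVal] at h
  | cst c =>
    cases c <;> simp [numVal] at h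
    subst h
    simp [sz]
  | succ s ih =>
    simp only [numVal, Option.map_eq_some_iff] at h
    obtain ⟨m, hm, rfl⟩ := h
    have := ih hm
    simp only [sz]
    omega

theorem Trm.length_tex_le (s : Trm) : s.tex.length ≤ s.sz := by
  induction s with
  | var k => exact (length_varTex_le k).trans (by simp [sz])
  | cst c => cases c <;> simp [tex, Cst.tex, sz]
  | succ s ih =>
    simp only [tex, sz]
    cases h : s.numVal with
    | none => simp; omega
    | some n =>
      have := numVal_le_sz h
      have := length_decimal_le (n + 1)
      simp
      omega
  | bin f s u hs hu => cases f <;> simp [tex, Bin.tex, sz] <;> omega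

/-- The extra 2 pays for the dollar signs around a formula. -/
theorem Frm.length_tex_add_two_le (φ : Frm) : φ.tex.length + 2 ≤ φ.sz := by
  induction φ with
  | eq s u =>
    have := s.length_tex_le; have := u.length_tex_le
    simp [tex, sz]; omega
  | mem s u =>
    have := s.length_tex_le; have := u.length_tex_le
    simp [tex, sz]; omega
  | neg φ ih => simp [tex, sz]; omega
  | imp φ ψ h₁ h₂ => simp [tex, sz]; omega
  | all k φ ih =>
    have := length_varTex_le k
    simp [tex, sz]; omega

theorem Frm.asciilen_le_sz (φ : Frm) : φ.asciilen ≤ φ.sz := by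
  have := φ.length_tex_add_two_le
  simp [asciilen]; omega

theorem Trm.one_le_sz (s : Trm) : 1 ≤ s.sz := by cases s <;> simp only [sz] <;> omega

/-- Each variable occurrence grows at most by the factor `r.sz`, and every other symbol is paid for
because `r.sz` is at least 1. -/
theorem Trm.sz_subst_le (s : Trm) (x : ℕ) (r : Trm) : (s.subst x r).sz ≤ s.sz * r.sz := by
  have := r.one_le_sz
  induction s with
  | var k =>
    simp only [subst]
    split_ifs
    · exact Nat.le_mul_of_pos_left _ (by simp [sz])
    · exact Nat.le_mul_of_pos_right _ this
  | cst c => exact Nat.le_mul_of_pos_right _ this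
  | succ s ih => simp only [subst, sz]; nlinarith
  | bin f s u hs hu => simp only [subst, sz]; nlinarith

theorem Frm.sz_subst_le (φ : Frm) (x : ℕ) (r : Trm) : (φ.subst x r).sz ≤ φ.sz * r.sz := by
  have := r.one_le_sz
  induction φ with
  | eq s u =>
    have := s.sz_subst_le x r; have := u.sz_subst_le x r
    simp only [subst, sz]; nlinarith
  | mem s u =>
    have := s.sz_subst_le x r; have := u.sz_subst_le x r
    simp only [subst, sz]; nlinarith
  | neg φ ih => simp only [subst, sz]; nlinarith
  | imp φ ψ h₁ h₂ => simp only [subst, sz]; nlinarith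
  | all k φ ih =>
    simp only [subst]
    split_ifs
    · exact Nat.le_mul_of_pos_right _ this
    · simp only [sz]; nlinarith

/-! ## Proof sequences -/

/-- Proofs from `T`, written with the last formula first. -/
inductive Seq (T : Set Frm) : List Frm → Prop
  | nil : Seq T []
  | ax {φ : Frm} {π : List Frm} : LogicalAxiom φ ∨ ZFC φ ∨ φ ∈ T → Seq T π → Seq T (φ :: π)
  | mp {φ ψ : Frm} {π : List Frm} : Frm.imp ψ φ ∈ π → ψ ∈ π → Seq T π → Seq T (φ :: π)
  | gen {φ : Frm} {k : ℕ} {π : List Frm} : φ ∈ π → Seq T π → Seq T (Frm.all k φ :: π)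

/-- The total size of the formulas of a proof. -/
def cost (π : List Frm) : ℕ := (π.map Frm.sz).sum

theorem cost_cons (φ : Frm) (π : List Frm) : cost (φ :: π) = φ.sz + cost π := by simp [cost]

theorem sz_le_cost {φ : Frm} {π : List Frm} (h : φ ∈ π) : φ.sz ≤ cost π :=
  List.single_le_sum (by simp) _ (List.mem_map_of_mem h)

theorem seqLen_reverse_le_cost (π : List Frm) : seqLen π.reverse ≤ cost π := by
  induction π with
  | nil => simp [seqLen]
  | cons φ π ih =>
    have := φ.asciilen_le_sz
    simp only [seqLen, List.reverse_cons, List.map_append, List.sum_append, cost_cons,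
      List.map_cons, List.map_nil, List.sum_cons, List.sum_nil] at *
    omega

/-- The formula with index `i` is an axiom or follows from earlier formulas. -/
def Justified (T π : List Frm) (i : Fin π.length) : Prop :=
  LogicalAxiom π[i] ∨ ZFC π[i] ∨ π[i] ∈ T ∨
    (∃ j k : Fin π.length, j < i ∧ k < i ∧ π[j] = Frm.imp π[k] π[i]) ∨
    (∃ j : Fin π.length, j < i ∧ ∃ k : ℕ, π[i] = Frm.all k π[j])

/-- Justifications refer to earlier indices, which do not change when a formula is appended. This
translates the membership conditions of `Seq` into the index conditions of `IsProof`. -/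
theorem Justified.concat {T π : List Frm} {φ : Frm} (h : ∀ i, Justified T π i)
    (hφ : LogicalAxiom φ ∨ ZFC φ ∨ φ ∈ T ∨ (∃ ψ ∈ π, Frm.imp ψ φ ∈ π) ∨
      ∃ ψ ∈ π, ∃ k, φ = Frm.all k ψ) : ∀ i, Justified T (π ++ [φ]) i := by
  rintro ⟨i, hi⟩
  have hl : (π ++ [φ]).length = π.length + 1 := by simp
  have hget : ∀ {j : ℕ} (hj : j < π.length) (hj' : j < (π ++ [φ]).length),
      (π ++ [φ])[j] = π[j] := fun hj _ => List.getElem_append_left hj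
  unfold Justified
  simp only [Fin.getElem_fin, Fin.exists_iff, Fin.mk_lt_mk]
  rcases Nat.lt_or_ge i π.length with hi' | hi'
  · have := h ⟨i, hi'⟩
    simp only [Justified, Fin.getElem_fin, Fin.exists_iff, Fin.mk_lt_mk] at this
    rw [hget hi' hi]
    refine this.imp_right (Or.imp_right (Or.imp_right (Or.imp ?_ ?_)))
    · rintro ⟨j, hj, k, hk, hji, hki, h⟩
      exact ⟨j, by omega, k, by omega, hji, hki, by rwa [hget hj, hget hk]⟩
    · rintro ⟨j, hj, hji, k, h⟩
      exact ⟨j, by omega, hji, k, by rwa [hget hj]⟩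
  · obtain rfl : i = π.length := by omega
    have hlast : (π ++ [φ])[π.length] = φ := by simp
    rw [hlast]
    refine hφ.imp_right (Or.imp_right (Or.imp_right (Or.imp ?_ ?_)))
    · rintro ⟨ψ, h₁, h₂⟩
      obtain ⟨k, hk, rfl⟩ := List.getElem_of_mem h₁
      obtain ⟨j, hj, h⟩ := List.getElem_of_mem h₂
      exact ⟨j, by omega, k, by omega, hj, hk, by rwa [hget hj, hget hk]⟩
    · rintro ⟨ψ, h₁, k, rfl⟩
      obtain ⟨j, hj, rfl⟩ := List.getElem_of_mem h₁
      exact ⟨j, by omega, hj, k, by rw [hget hj]⟩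

theorem Seq.isProof {T : List Frm} {φ : Frm} {π : List Frm} (h : Seq {ψ | ψ ∈ T} (φ :: π)) :
    IsProof T (φ :: π).reverse φ := by
  refine ⟨by simp, ?_⟩
  generalize φ :: π = ρ at h
  change ∀ i, Justified T ρ.reverse i
  induction h with
  | nil => intro i; exact i.elim0
  | ax h _ ih =>
    rw [List.reverse_cons]
    exact Justified.concat ih (h.imp_right (Or.imp_right .inl))
  | mp h₁ h₂ _ ih =>
    rw [List.reverse_cons]
    exact Justified.concat ih
      (.inr (.inr (.inr (.inl ⟨_, List.mem_reverse.2 h₂, List.mem_reverse.2 h₁⟩))))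
  | gen h _ ih =>
    rw [List.reverse_cons]
    exact Justified.concat ih (.inr (.inr (.inr (.inr ⟨_, List.mem_reverse.2 h, _, rfl⟩))))

/-- Every tail of such a list is again a proof, so whatever was written after `φ` can be discarded.
This makes `φ` the last formula, as `IsProof` demands. -/
theorem Seq.suffix {T : Set Frm} {φ : Frm} {π : List Frm} (h : Seq T π) (hφ : φ ∈ π) :
    ∃ ρ, Seq T (φ :: ρ) ∧ cost (φ :: ρ) ≤ cost π := by
  induction h with
  | nil => simp at hφ
  | @ax ψ π h₁ h₂ ih =>
    rcases List.mem_cons.1 hφ with rfl | hφ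
    · exact ⟨π, .ax h₁ h₂, le_rfl⟩
    · obtain ⟨ρ, h, h'⟩ := ih hφ
      exact ⟨ρ, h, h'.trans (by simp [cost_cons])⟩
  | @mp ψ χ π h₁ h₂ h₃ ih =>
    rcases List.mem_cons.1 hφ with rfl | hφ
    · exact ⟨π, .mp h₁ h₂ h₃, le_rfl⟩
    · obtain ⟨ρ, h, h'⟩ := ih hφ
      exact ⟨ρ, h, h'.trans (by simp [cost_cons])⟩
  | @gen ψ k π h₁ h₂ ih =>
    rcases List.mem_cons.1 hφ with rfl | hφ
    · exact ⟨π, .gen h₁ h₂, le_rfl⟩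
    · obtain ⟨ρ, h, h'⟩ := ih hφ
      exact ⟨ρ, h, h'.trans (by simp [cost_cons])⟩

/-- Formulas already proved may be used as additional hypotheses. -/
theorem Seq.cut {T Δ : Set Frm} {π₁ π₂ : List Frm} (h₁ : Seq T π₁) (hΔ : ∀ φ ∈ Δ, φ ∈ π₁)
    (h₂ : Seq (T ∪ Δ) π₂) :
    ∃ π₃, Seq T π₃ ∧ π₁ ⊆ π₃ ∧ π₂ ⊆ π₃ ∧ cost π₃ ≤ cost π₁ + cost π₂ := by
  induction h₂ with
  | nil => exact ⟨π₁, h₁, by simp, by simp, by simp [cost]⟩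
  | @ax φ π h _ ih =>
    obtain ⟨ρ, hρ, hs₁, hs₂, hc⟩ := ih
    -- A hypothesis from `Δ` already stands in the first proof, so this line is dropped.
    by_cases hφ : φ ∈ Δ
    · exact ⟨ρ, hρ, hs₁, List.cons_subset.2 ⟨hs₁ (hΔ φ hφ), hs₂⟩, by rw [cost_cons]; omega⟩
    · refine ⟨φ :: ρ, .ax ?_ hρ, fun _ h => List.mem_cons_of_mem _ (hs₁ h),
        List.cons_subset_cons _ hs₂, by simp only [cost_cons]; omega⟩
      rcases h with h | h | h | h
      exacts [.inl h, .inr (.inl h), .inr (.inr h), absurd h hφ]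
  | @mp φ ψ π h₃ h₄ _ ih =>
    obtain ⟨ρ, hρ, hs₁, hs₂, hc⟩ := ih
    exact ⟨φ :: ρ, .mp (hs₂ h₃) (hs₂ h₄) hρ, fun _ h => List.mem_cons_of_mem _ (hs₁ h),
      List.cons_subset_cons _ hs₂, by simp only [cost_cons]; omega⟩
  | @gen φ k π h₃ _ ih =>
    obtain ⟨ρ, hρ, hs₁, hs₂, hc⟩ := ih
    exact ⟨_ :: ρ, .gen (hs₂ h₃) hρ, fun _ h => List.mem_cons_of_mem _ (hs₁ h),
      List.cons_subset_cons _ hs₂, by simp only [cost_cons]; omega⟩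

theorem Seq.append {T : Set Frm} {π₁ π₂ : List Frm} (h₁ : Seq T π₁) (h₂ : Seq T π₂) :
    ∃ π₃, Seq T π₃ ∧ π₁ ⊆ π₃ ∧ π₂ ⊆ π₃ ∧ cost π₃ ≤ cost π₁ + cost π₂ :=
  h₁.cut (Δ := ∅) (by simp) (by simpa using h₂)

/-- `φ` has a proof from `T` of cost at most `N`. -/
def Prv (T : Set Frm) (N : ℕ) (φ : Frm) : Prop := ∃ π, Seq T π ∧ φ ∈ π ∧ cost π ≤ N

/-- Concatenation of `w` proofs, so that a whole row is available in one sequence. -/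
theorem Prv.collect {T : Set Frm} {N : ℕ} {g : ℕ → Frm} (w : ℕ) (h : ∀ k < w, Prv T N (g k)) :
    ∃ π, Seq T π ∧ (∀ k < w, g k ∈ π) ∧ cost π ≤ w * N := by
  induction w with
  | zero => exact ⟨[], .nil, by simp, by simp [cost]⟩
  | succ w ih =>
    obtain ⟨π₁, hπ₁, hg₁, hc₁⟩ := ih fun k hk => h k (by omega)
    obtain ⟨π₂, hπ₂, hg₂, hc₂⟩ := h w (by omega)
    obtain ⟨π₃, hπ₃, hs₁, hs₂, hc₃⟩ := hπ₁.append hπ₂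
    refine ⟨π₃, hπ₃, fun k hk => ?_, by rw [add_mul]; omega⟩
    rcases Nat.lt_succ_iff_lt_or_eq.1 hk with hk | rfl
    exacts [hs₁ (hg₁ k hk), hs₂ hg₂]

/-! ## Families of formulas with proofs of polynomial size -/

/-- A family of theories, each with a number that measures its size. -/
structure Family (ι : Type*) where
  size : ι → ℕ
  thy : ι → Set Frm

namespace Family

variable {ι κ : Type*}

/-- A function on the index set is bounded by a polynomial in the size. -/
def Small (F : Family ι) (f : ι → ℕ) : Prop :=
  ∃ P : Polynomial ℕ, ∀ x, f x ≤ P.eval (F.size x)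

def TSmall (F : Family ι) (t : ι → Trm) : Prop := F.Small fun x => (t x).sz

def FSmall (F : Family ι) (φ : ι → Frm) : Prop := F.Small fun x => (φ x).sz

/-- The formulas of a family have proofs of polynomial size. -/
def Proves (F : Family ι) (φ : ι → Frm) : Prop :=
  ∃ f, F.Small f ∧ ∀ x, Prv (F.thy x) (f x) (φ x)

/-- Reindexing. -/
def comap (F : Family ι) (g : κ → ι) : Family κ := ⟨F.size ∘ g, F.thy ∘ g⟩

/-- Adding hypotheses. -/
def adjoin (F : Family ι) (Δ : ι → Set Frm) : Family ι := ⟨F.size, fun x => F.thy x ∪ Δ x⟩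

/-! ### Closure properties of polynomial bounds -/

section Small

variable {F : Family ι}

theorem Small.mono {f g : ι → ℕ} (hg : F.Small g) (h : ∀ x, f x ≤ g x) : F.Small f := by
  obtain ⟨P, hP⟩ := hg
  exact ⟨P, fun x => (h x).trans (hP x)⟩

@[simp] theorem small_const (c : ℕ) : F.Small fun _ => c := ⟨.C c, by simp⟩

@[simp] theorem Small.add {f g : ι → ℕ} (hf : F.Small f) (hg : F.Small g) :
    F.Small fun x => f x + g x := by
  obtain ⟨P, hP⟩ := hf
  obtain ⟨Q, hQ⟩ := hg
  exact ⟨P + Q, fun x => by rw [Polynomial.eval_add]; exact add_le_add (hP x) (hQ x)⟩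

theorem Small.mul {f g : ι → ℕ} (hf : F.Small f) (hg : F.Small g) :
    F.Small fun x => f x * g x := by
  obtain ⟨P, hP⟩ := hf
  obtain ⟨Q, hQ⟩ := hg
  exact ⟨P * Q, fun x => by rw [Polynomial.eval_mul]; exact Nat.mul_le_mul (hP x) (hQ x)⟩

theorem small_size : F.Small F.size := ⟨.X, by simp⟩

theorem Small.comap {f : ι → ℕ} (hf : F.Small f) (g : κ → ι) :
    (F.comap g).Small fun y => f (g y) := by
  obtain ⟨P, hP⟩ := hf
  exact ⟨P, fun y => hP (g y)⟩

theorem Small.adjoin {f : ι → ℕ} (hf : F.Small f) (Δ : ι → Set Frm) : (F.adjoin Δ).Small f := hf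

@[simp] theorem tsmall_const (t : Trm) : F.TSmall fun _ => t := small_const _

@[simp] theorem tsmall_num {f : ι → ℕ} (hf : F.Small f) : F.TSmall fun x => Trm.num (f x) := by
  have h : ∀ n, (Trm.num n).sz = n * 10 + 10 := fun n => by
    induction n with
    | zero => rfl
    | succ n ih => simp only [Trm.num, Trm.sz, ih]; ring
  refine ((hf.mul (small_const 10)).add (small_const 10)).mono fun x => ?_
  rw [h]

@[simp] theorem tsmall_bin {f : Bin} {s u : ι → Trm} (hs : F.TSmall s) (hu : F.TSmall u) :
    F.TSmall fun x => Trm.bin f (s x) (u x) :=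
  (hs.add hu).add (small_const 10)

@[simp] theorem fsmall_const (φ : Frm) : F.FSmall fun _ => φ := small_const _

@[simp] theorem fsmall_eq {s u : ι → Trm} (hs : F.TSmall s) (hu : F.TSmall u) :
    F.FSmall fun x => Frm.eq (s x) (u x) :=
  (hs.add hu).add (small_const 10)

@[simp] theorem fsmall_mem {s u : ι → Trm} (hs : F.TSmall s) (hu : F.TSmall u) :
    F.FSmall fun x => Frm.mem (s x) (u x) :=
  (hs.add hu).add (small_const 10)

@[simp] theorem fsmall_neg {φ : ι → Frm} (hφ : F.FSmall φ) : F.FSmall fun x => Frm.neg (φ x) :=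
  hφ.add (small_const 10)

@[simp] theorem fsmall_imp {φ ψ : ι → Frm} (hφ : F.FSmall φ) (hψ : F.FSmall ψ) :
    F.FSmall fun x => Frm.imp (φ x) (ψ x) :=
  (hφ.add hψ).add (small_const 20)

@[simp] theorem fsmall_all {k : ℕ} {φ : ι → Frm} (hφ : F.FSmall φ) :
    F.FSmall fun x => Frm.all k (φ x) :=
  ((small_const k).add hφ).add (small_const 20)

@[simp] theorem fsmall_and {φ ψ : ι → Frm} (hφ : F.FSmall φ) (hψ : F.FSmall ψ) :
    F.FSmall fun x => Frm.and (φ x) (ψ x) :=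
  fsmall_neg (fsmall_imp hφ (fsmall_neg hψ))

@[simp] theorem fsmall_ex {k : ℕ} {φ : ι → Frm} (hφ : F.FSmall φ) :
    F.FSmall fun x => Frm.ex k (φ x) :=
  fsmall_neg (fsmall_all (fsmall_neg hφ))

theorem FSmall.subst {k : ℕ} {φ : ι → Frm} {r : ι → Trm} (hφ : F.FSmall φ) (hr : F.TSmall r) :
    F.FSmall fun x => (φ x).subst k (r x) :=
  (hφ.mul hr).mono fun x => (φ x).sz_subst_le k (r x)

end Small

/-! ### Derived rules with polynomial overhead -/

section Proves

variable {F : Family ι} {φ ψ χ : ι → Frm}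

/-- A formula occurs in its own proof, so a bound for the proof bounds the formula. -/
theorem Proves.fsmall (h : F.Proves φ) : F.FSmall φ := by
  obtain ⟨f, hf, h⟩ := h
  refine hf.mono fun x => ?_
  obtain ⟨π, _, h₂, h₃⟩ := h x
  exact (sz_le_cost h₂).trans h₃

theorem proves_ax (hs : F.FSmall φ) (h : ∀ x, LogicalAxiom (φ x) ∨ ZFC (φ x) ∨ φ x ∈ F.thy x) :
    F.Proves φ :=
  ⟨_, hs, fun x => ⟨[φ x], .ax (h x) .nil, by simp, by simp [cost]⟩⟩

theorem proves_logical (hs : F.FSmall φ) (h : ∀ x, LogicalAxiom (φ x)) : F.Proves φ :=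
  proves_ax hs fun x => .inl (h x)

theorem proves_zfc {φ : Frm} (h : ZFC φ) : F.Proves fun _ => φ :=
  proves_ax (fsmall_const φ) fun _ => .inr (.inl h)

theorem proves_hyp (hs : F.FSmall φ) (h : ∀ x, φ x ∈ F.thy x) : F.Proves φ :=
  proves_ax hs fun x => .inr (.inr (h x))

theorem Proves.mp (h₁ : F.Proves fun x => Frm.imp (φ x) (ψ x)) (h₂ : F.Proves φ) :
    F.Proves ψ := by
  obtain ⟨f, hf, h⟩ := h₁
  obtain ⟨g, hg, h'⟩ := h₂
  -- The second `f` pays for the new line: the conclusion is a subformula of the implication, which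
  -- occurs in the first proof.
  refine ⟨_, (hf.add hg).add hf, fun x => ?_⟩
  obtain ⟨π₁, hπ₁, hm₁, hc₁⟩ := h x
  obtain ⟨π₂, hπ₂, hm₂, hc₂⟩ := h' x
  obtain ⟨π₃, hπ₃, hs₁, hs₂, hc₃⟩ := hπ₁.append hπ₂
  refine ⟨ψ x :: π₃, .mp (hs₁ hm₁) (hs₂ hm₂) hπ₃, by simp, ?_⟩
  have := (sz_le_cost hm₁).trans hc₁
  simp only [cost_cons, Frm.sz] at *
  omega

theorem Proves.gen (k : ℕ) (h : F.Proves φ) : F.Proves fun x => Frm.all k (φ x) := by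
  obtain ⟨f, hf, h⟩ := h
  refine ⟨_, hf.add (hf.add (small_const (k + 20))), fun x => ?_⟩
  obtain ⟨π, hπ, hm, hc⟩ := h x
  refine ⟨Frm.all k (φ x) :: π, .gen hm hπ, by simp, ?_⟩
  have := (sz_le_cost hm).trans hc
  simp only [cost_cons, Frm.sz] at *
  omega

theorem proves_taut (hs : F.FSmall φ) (h : ∀ x, (φ x).Tautology) : F.Proves φ :=
  proves_logical hs fun x => .taut (h x)

theorem Proves.taut₁ (h₁ : F.Proves φ) (hs : F.FSmall ψ)
    (h : ∀ x, ((φ x).imp (ψ x)).Tautology) : F.Proves ψ :=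
  (proves_taut (fsmall_imp h₁.fsmall hs) h).mp h₁

theorem Proves.taut₂ (h₁ : F.Proves φ) (h₂ : F.Proves ψ) (hs : F.FSmall χ)
    (h : ∀ x, ((φ x).imp ((ψ x).imp (χ x))).Tautology) : F.Proves χ :=
  ((proves_taut (fsmall_imp h₁.fsmall (fsmall_imp h₂.fsmall hs)) h).mp h₁).mp h₂

theorem Proves.inst {k : ℕ} {r : ι → Trm} (h : F.Proves fun x => Frm.all k (φ x))
    (hr : F.TSmall r) (hsub : ∀ x, (φ x).Substitutable k (r x))
    (he : ∀ x, (φ x).subst k (r x) = ψ x) : F.Proves ψ := by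
  have hφ : F.FSmall φ := h.fsmall.mono fun x => by simp only [Frm.sz]; omega
  obtain rfl : (fun x => (φ x).subst k (r x)) = ψ := funext he
  exact (proves_logical (fsmall_imp h.fsmall (hφ.subst hr)) fun x => .inst (hsub x)).mp h

/-- The case distinction takes place outside the formal system: different indices may have proofs of
different shape, and the sum of the two polynomials bounds both kinds. -/
theorem Proves.cases (p : ι → Prop)
    (h₁ : (F.comap (Subtype.val : {x // p x} → ι)).Proves fun y => φ y.1)
    (h₂ : (F.comap (Subtype.val : {x // ¬ p x} → ι)).Proves fun y => φ y.1) : F.Proves φ := by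
  obtain ⟨f, ⟨P, hP⟩, hf⟩ := h₁
  obtain ⟨g, ⟨Q, hQ⟩, hg⟩ := h₂
  refine ⟨fun x => (P + Q).eval (F.size x), ⟨P + Q, fun _ => le_rfl⟩, fun x => ?_⟩
  simp only [Polynomial.eval_add]
  by_cases hx : p x
  · obtain ⟨π, hπ, hm, hc⟩ := hf ⟨x, hx⟩
    exact ⟨π, hπ, hm, hc.trans ((hP ⟨x, hx⟩).trans (Nat.le_add_right _ _))⟩
  · obtain ⟨π, hπ, hm, hc⟩ := hg ⟨x, hx⟩
    exact ⟨π, hπ, hm, hc.trans ((hQ ⟨x, hx⟩).trans (Nat.le_add_left _ _))⟩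

/-- Induction on `j ≤ f`: the rows `φ_{j,0}, …, φ_{j,w-1}` are proved one after the other. -/
theorem proves_of_rows {f w k₀ : ι → ℕ} (hf : F.Small f) (hw : F.Small w)
    {φ : ι → ℕ → ℕ → Frm}
    (base : (F.comap (fun y : {p : ι × ℕ // p.2 < w p.1} => y.1.1)).Proves
      fun y => φ y.1.1 0 y.1.2)
    (step : ((F.comap (fun y : {p : ι × ℕ × ℕ // p.2.1 < f p.1 ∧ p.2.2 < w p.1} => y.1.1)).adjoin
      fun y => {ψ | ∃ k < w y.1.1, ψ = φ y.1.1 y.1.2.1 k}).Proves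
      fun y => φ y.1.1 (y.1.2.1 + 1) y.1.2.2)
    (hk : ∀ x, k₀ x < w x) : F.Proves fun x => φ x (f x) (k₀ x) := by
  -- The triples `(x, j, k)` inherit the size of `x`, so `P` and `Q` depend neither on the row nor
  -- on the square. The first row costs `w * P` and each later row adds `w * Q`.
  obtain ⟨b, ⟨P, hP⟩, hb⟩ := base
  obtain ⟨c, ⟨Q, hQ⟩, hc⟩ := step
  have hPs : F.Small fun x => P.eval (F.size x) := ⟨P, fun _ => le_rfl⟩
  have hQs : F.Small fun x => Q.eval (F.size x) := ⟨Q, fun _ => le_rfl⟩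
  refine ⟨_, (hw.mul hPs).add (hf.mul (hw.mul hQs)), fun x => ?_⟩
  suffices h : ∀ j ≤ f x, ∃ π, Seq (F.thy x) π ∧ (∀ k < w x, φ x j k ∈ π) ∧
      cost π ≤ w x * P.eval (F.size x) + j * (w x * Q.eval (F.size x)) by
    obtain ⟨π, hπ, hm, hc⟩ := h (f x) le_rfl
    exact ⟨π, hπ, hm _ (hk x), hc⟩
  intro j hj
  induction j with
  | zero =>
    obtain ⟨π, hπ, hm, hc⟩ := Prv.collect (T := F.thy x) (N := P.eval (F.size x))
      (g := φ x 0) (w x) fun k hk => by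
        obtain ⟨π, hπ, hm, hc⟩ := hb ⟨(x, k), hk⟩
        exact ⟨π, hπ, hm, hc.trans (hP _)⟩
    exact ⟨π, hπ, hm, by simpa using hc⟩
  | succ j ih =>
    obtain ⟨π₁, hπ₁, hm₁, hc₁⟩ := ih (by omega)
    obtain ⟨π₂, hπ₂, hm₂, hc₂⟩ := Prv.collect (N := Q.eval (F.size x))
      (T := F.thy x ∪ {ψ | ∃ k < w x, ψ = φ x j k})
      (g := φ x (j + 1)) (w x) fun k hk => by
        obtain ⟨π, hπ, hm, hc⟩ := hc ⟨(x, j, k), hj, hk⟩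
        exact ⟨π, hπ, hm, hc.trans (hQ _)⟩
    -- The cut shares row `j` among all squares of row `j + 1`, so the cost grows by a sum and not
    -- by a factor.
    obtain ⟨π₃, hπ₃, hs₁, hs₂, hc₃⟩ := hπ₁.cut (by rintro _ ⟨k, hk, rfl⟩; exact hm₁ k hk) hπ₂
    refine ⟨π₃, hπ₃, fun k hk => hs₂ (hm₂ k hk), ?_⟩
    rw [add_mul]
    omega

end Proves

end Family

/-! ## Substitution of closed terms -/

@[simp] theorem Trm.not_occurs_num (x n : ℕ) : ¬ (num n).Occurs x := by
  induction n with
  | zero => exact id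
  | succ n ih => exact ih

@[simp] theorem Trm.subst_num (n x : ℕ) (r : Trm) : (num n).subst x r = num n := by
  induction n with
  | zero => rfl
  | succ n ih => simp [num, subst, ih]

theorem Frm.substitutable_of_closed {r : Trm} (hr : ∀ k, ¬ r.Occurs k) (x : ℕ) (φ : Frm) :
    φ.Substitutable x r := by
  induction φ with
  | eq s u => trivial
  | mem s u => trivial
  | neg φ ih => exact ih
  | imp φ ψ h₁ h₂ => exact ⟨h₁, h₂⟩
  | all k φ ih => exact .inr ⟨hr k, ih⟩

@[simp] theorem Frm.substitutable_num (n x : ℕ) (φ : Frm) : φ.Substitutable x (.num n) :=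
  substitutable_of_closed (fun k => Trm.not_occurs_num k n) x φ

theorem Frm.AtomRepl.substitutable {x y z : ℕ} {r : Trm} {α β : Frm} (h : AtomRepl x y α β) :
    α.Substitutable z r ∧ β.Substitutable z r := by
  cases h <;> exact ⟨trivial, trivial⟩

theorem Frm.AtomRepl.substitutable_subst {x y z w : ℕ} {r s : Trm} {α β : Frm}
    (h : AtomRepl x y α β) :
    (α.subst w s).Substitutable z r ∧ (β.subst w s).Substitutable z r := by
  cases h <;> exact ⟨trivial, trivial⟩

namespace Family

variable {ι : Type*} {F : Family ι}

/-! ## Equality -/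

theorem proves_refl {t : ι → Trm} (ht : F.TSmall t) : F.Proves fun x => Frm.eq (t x) (t x) := by
  have h : F.Proves fun _ => Frm.eq (.var 100) (.var 100) :=
    proves_logical (by simp) fun _ => .refl
  exact (h.gen 100).inst ht (fun _ => trivial) fun x => by simp [Frm.subst, Trm.subst]

/-- The Leibniz law for terms `s`, `u`; the variables `x_100`, `x_101` mark the replaced
occurrence. -/
theorem proves_leibniz {s u : ι → Trm} (α β : ι → Frm) {α' β' : ι → Frm} (hs : F.TSmall s)
    (hu : F.TSmall u) (hα : F.FSmall α) (hβ : F.FSmall β)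
    (hr : ∀ x, Frm.AtomRepl 100 101 (α x) (β x)) (hcl : ∀ x, ¬ (s x).Occurs 101)
    (hsub : ∀ x, (s x).subst 101 (u x) = s x)
    (hα' : ∀ x, ((α x).subst 100 (s x)).subst 101 (u x) = α' x)
    (hβ' : ∀ x, ((β x).subst 100 (s x)).subst 101 (u x) = β' x) :
    F.Proves fun x => Frm.imp (.eq (s x) (u x)) (.imp (α' x) (β' x)) := by
  -- The axiom speaks of variables only, so both are generalized and then instantiated. The term `s`
  -- is inserted under the quantifier on `x_101`, whence `hcl`; the second substitution passes
  -- through `s` as well, whence `hsub`.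
  have h : F.Proves fun x => Frm.imp (.eq (.var 100) (.var 101)) (.imp (α x) (β x)) :=
    proves_logical (by simp (maxDischargeDepth := 12) [hα, hβ]) fun x => .leibniz (hr x)
  refine (((h.gen 101).gen 100).inst (ψ := fun x => Frm.all 101 (Frm.imp (.eq (s x) (.var 101))
    (.imp ((α x).subst 100 (s x)) ((β x).subst 100 (s x))))) hs
    (fun x => .inr ⟨hcl x, trivial, (hr x).substitutable⟩)
    fun x => by simp [Frm.subst, Trm.subst]).inst hu
    (fun x => ⟨trivial, (hr x).substitutable_subst⟩) fun x => ?_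
  simp [hα', hβ', hsub, Frm.subst, Trm.subst]

/-! ## Numerals -/

/-- The closure condition of an inductive set, instantiated at the numeral `n`. -/
theorem Proves.succ_mem_inductiveSet {n : ι → ℕ} (hn : F.Small n)
    (h : F.Proves fun x => Frm.imp (inductiveSet (.var 1)) (.mem (.num (n x)) (.var 1))) :
    F.Proves fun x => Frm.imp (inductiveSet (.var 1)) (.mem (.num (n x + 1)) (.var 1)) := by
  refine h.taut₂ (ψ := fun x => Frm.imp (Frm.allIn 9 (.var 1) (.mem (.succ (.var 9)) (.var 1)))
    (Frm.imp (.mem (.num (n x)) (.var 1)) (.mem (.num (n x + 1)) (.var 1))))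
    (proves_logical (by simp (maxDischargeDepth := 12) [hn]) fun x => ?_)
      (by simp (maxDischargeDepth := 12) [hn]) fun x V hn hi => ?_
  · have := LogicalAxiom.inst (x := 9) (r := .num (n x))
      (α := .imp (.mem (.var 9) (.var 1)) (.mem (.succ (.var 9)) (.var 1))) (by simp)
    simpa [Frm.subst, Trm.subst, Frm.allIn, Trm.num] using this
  · simp only [inductiveSet, Frm.and, hn, hi]
    tauto

/-- By its definition `ω` consists of the common elements of all inductive sets, so it suffices to
climb from `0` to `n` inside an arbitrary inductive set `x_1`. This is an induction along rows of
width 1. -/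
theorem proves_num_mem_omega {n : ι → ℕ} (hn : F.Small n) :
    F.Proves fun x => Frm.mem (.num (n x)) .omega := by
  have key : F.Proves fun x => Frm.imp (inductiveSet (.var 1)) (.mem (.num (n x)) (.var 1)) := by
    refine proves_of_rows (k₀ := fun _ => 0) (w := fun _ => 1) hn (small_const 1)
      (φ := fun _ j _ => Frm.imp (inductiveSet (.var 1)) (.mem (.num j) (.var 1))) ?_ ?_ (by simp)
    · refine proves_taut (fsmall_const _) fun _ V hn hi => ?_
      simp only [inductiveSet, Frm.and, hn, hi]
      tauto
    · have hj := (hn.comap fun y : {p : ι × ℕ × ℕ // p.2.1 < n p.1 ∧ p.2.2 < 1} => y.1.1).mono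
        fun y => y.2.1.le
      exact Proves.succ_mem_inductiveSet (hj.adjoin _)
        (proves_hyp (fsmall_imp (fsmall_const _) (fsmall_mem (tsmall_num (hj.adjoin _))
          (tsmall_const _))) fun y => .inr ⟨0, by simp, rfl⟩)
  have h : F.Proves fun x => Frm.iff (.mem (.num (n x)) .omega)
      (.all 1 (.imp (inductiveSet (.var 1)) (.mem (.num (n x)) (.var 1)))) :=
    (proves_zfc .def_omega).inst (tsmall_num hn) (by simp) fun x => by
      simp [Frm.subst, Trm.subst, Frm.iff, Frm.and, inductiveSet, Frm.allIn]
  refine h.taut₂ (key.gen 1) (by simp (maxDischargeDepth := 12) [hn]) fun x V hn hi => ?_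
  simp only [Frm.iff, Frm.and, hn, hi]
  tauto

theorem proves_mem_succ {m n : ι → ℕ} (hm : F.Small m) (hn : F.Small n) :
    F.Proves fun x => Frm.iff (.mem (.num (m x)) (.num (n x + 1)))
      (.or (.mem (.num (m x)) (.num (n x))) (.eq (.num (m x)) (.num (n x)))) :=
  ((proves_zfc .def_succ).inst (tsmall_num hn) (by simp) fun _ => rfl).inst
    (tsmall_num hm) (by simp) fun x => by
      simp [Frm.subst, Trm.subst, Frm.iff, Frm.and, Frm.or, Trm.num]

/-- Starting with `m ∈ m + 1`, the definition of the successor carries membership of `m` upwards;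
the induction runs over the difference `n - m - 1`. -/
theorem proves_num_mem_num {m n : ι → ℕ} (hn : F.Small n) (h : ∀ x, m x < n x) :
    F.Proves fun x => Frm.mem (.num (m x)) (.num (n x)) := by
  have hm : F.Small m := hn.mono fun x => (h x).le
  have key : F.Proves fun x => Frm.mem (.num (m x)) (.num (m x + (n x - m x - 1) + 1)) := by
    refine proves_of_rows (k₀ := fun _ => 0) (w := fun _ => 1) (f := fun x => n x - m x - 1)
      (hn.mono fun x => by omega) (small_const 1)
      (φ := fun x j _ => Frm.mem (.num (m x)) (.num (m x + j + 1))) ?_ ?_ (by simp)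
    · have hm' := hm.comap fun y : {p : ι × ℕ // p.2 < 1} => y.1.1
      refine (proves_mem_succ hm' hm').taut₂ (proves_refl (tsmall_num hm'))
        (by simp (maxDischargeDepth := 12) [hm'])
        fun x V hn hi => ?_
      simp only [Frm.iff, Frm.and, Frm.or, hn, hi, add_zero]
      tauto
    · have hn' := (hn.comap fun y : {p : ι × ℕ × ℕ // p.2.1 < n p.1 - m p.1 - 1 ∧ p.2.2 < 1} =>
          y.1.1).adjoin fun y => {ψ | ∃ k < 1, ψ = Frm.mem (.num (m y.1.1))
            (.num (m y.1.1 + y.1.2.1 + 1))}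
      have hm' := hn'.mono fun y => (h y.1.1).le
      have hj := hn'.mono (f := fun y => m y.1.1 + y.1.2.1 + 1) fun y => by
        have := y.2.1
        omega
      refine (proves_mem_succ hm' hj).taut₂ (ψ := fun y => Frm.mem (.num (m y.1.1))
        (.num (m y.1.1 + y.1.2.1 + 1))) 
        (proves_hyp (fsmall_mem (tsmall_num hm') (tsmall_num hj)) fun y => .inr ⟨0, by simp, rfl⟩)
        (fsmall_mem (tsmall_num hm') (tsmall_num (hj.add (small_const 1)))) fun y V hn hi => ?_
      simp only [Frm.iff, Frm.and, Frm.or, hn, hi, ← add_assoc]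
      tauto
  convert key using 4 with x
  have := h x
  omega

/-- Foundation for the set `{n, n}`: its minimal element can only be `n`, and `n ∈ n` would
contradict minimality. No induction on `n` is needed. -/
theorem proves_num_not_mem_self {n : ι → ℕ} (hn : F.Small n) :
    F.Proves fun x => Frm.neg (.mem (.num (n x)) (.num (n x))) := by
  have hr : F.TSmall fun x => Trm.num (n x) := tsmall_num hn
  have hup : F.Proves fun x => Frm.all 2 (Frm.iff
      (.mem (.var 2) (.upair (.num (n x)) (.num (n x))))
      (.or (.eq (.var 2) (.num (n x))) (.eq (.var 2) (.num (n x))))) :=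
    ((proves_zfc .def_upair).inst hr (by simp) fun _ => rfl).inst hr (by simp) fun x => by
      simp [Frm.subst, Trm.subst, Frm.iff, Frm.and, Frm.or]
  have hmem : F.Proves fun x => Frm.mem (.num (n x)) (.upair (.num (n x)) (.num (n x))) := by
    refine (hup.inst (ψ := fun x => Frm.iff
      (.mem (.num (n x)) (.upair (.num (n x)) (.num (n x))))
      (.or (.eq (.num (n x)) (.num (n x))) (.eq (.num (n x)) (.num (n x)))))
      hr (by simp) fun x => by simp [Frm.subst, Trm.subst, Frm.iff, Frm.and, Frm.or]).taut₂
      (proves_refl hr) (by simp (maxDischargeDepth := 12) [hr]) fun x V hn hi => ?_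
    simp only [Frm.iff, Frm.and, Frm.or, hn, hi]
    tauto
  have hmem₁ : F.Proves fun x => Frm.imp (.mem (.var 1) (.upair (.num (n x)) (.num (n x))))
      (.eq (.var 1) (.num (n x))) := by
    refine (hup.inst (r := fun _ => .var 1) (ψ := fun x => Frm.iff
      (.mem (.var 1) (.upair (.num (n x)) (.num (n x))))
      (.or (.eq (.var 1) (.num (n x))) (.eq (.var 1) (.num (n x)))))
      (by simp) (fun x => by simp [Frm.Substitutable, Frm.iff, Frm.and, Frm.or])
      fun x => by simp [Frm.subst, Trm.subst, Frm.iff, Frm.and, Frm.or]).taut₁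
      (by simp (maxDischargeDepth := 12) [hr]) fun x V hn hi => ?_
    simp only [Frm.iff, Frm.and, Frm.or, hn, hi]
    tauto
  -- Symmetry of equality: the left occurrence in `x_1 = x_1` is replaced.
  have hsymm : F.Proves fun x => Frm.imp (.eq (.var 1) (.num (n x)))
      (.imp (.eq (.var 1) (.var 1)) (.eq (.num (n x)) (.var 1))) :=
    proves_leibniz (fun _ => .eq (.var 100) (.var 100)) (fun _ => .eq (.var 101) (.var 100))
      (by simp) hr (by simp) (by simp) (fun _ => .eq_left .here) (by simp [Trm.Occurs])
      (by simp [Trm.subst]) (by simp [Frm.subst, Trm.subst]) (by simp [Frm.subst, Trm.subst])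
  have hrw : F.Proves fun x => Frm.imp (.eq (.num (n x)) (.var 1))
      (.imp (.mem (.num (n x)) (.num (n x))) (.mem (.num (n x)) (.var 1))) :=
    proves_leibniz (fun x => .mem (.num (n x)) (.var 100)) (fun x => .mem (.num (n x)) (.var 101))
      hr (by simp) (by simp (maxDischargeDepth := 12) [hr])
        (by simp (maxDischargeDepth := 12) [hr]) (fun _ => .mem_right .here) (by simp)
      (by simp) (by simp [Frm.subst, Trm.subst]) (by simp [Frm.subst, Trm.subst])
  have hex : F.Proves fun x => Frm.imp
      (.and (.mem (.num (n x)) (.upair (.num (n x)) (.num (n x)))) (.mem (.num (n x)) (.var 1)))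
      (.exIn 2 (.upair (.num (n x)) (.num (n x))) (.mem (.var 2) (.var 1))) := by
    refine proves_logical (by simp (maxDischargeDepth := 12) [hr, Frm.exIn]) fun x => ?_
    have := LogicalAxiom.exIntro (x := 2) (r := .num (n x))
      (α := .and (.mem (.var 2) (.upair (.num (n x)) (.num (n x)))) (.mem (.var 2) (.var 1)))
      (by simp)
    simpa [Frm.subst, Trm.subst, Frm.and, Frm.exIn] using this
  have hrefl : F.Proves fun _ => Frm.eq (.var 1) (.var 1) := proves_refl (by simp)
  have hsmall : F.FSmall fun x => Frm.and (.mem (.var 1) (.upair (.num (n x)) (.num (n x))))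
      (.neg (.exIn 2 (.upair (.num (n x)) (.num (n x))) (.mem (.var 2) (.var 1)))) := by
    simp (maxDischargeDepth := 12) [hr, Frm.exIn]
  -- If `n ∈ n`, then any `x_1` in `{n, n}` equals `n`, so `n` itself lies in both `x_1` and `{n,
  -- n}`, and `x_1` is not minimal.
  have hmin : F.Proves fun x => Frm.imp (.mem (.num (n x)) (.num (n x)))
      (.neg (.and (.mem (.var 1) (.upair (.num (n x)) (.num (n x))))
        (.neg (.exIn 2 (.upair (.num (n x)) (.num (n x))) (.mem (.var 2) (.var 1)))))) := by
    refine (Proves.taut₂ (χ := fun x => Frm.imp (.mem (.num (n x)) (.num (n x)))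
      (.imp (.mem (.var 1) (.upair (.num (n x)) (.num (n x)))) (.mem (.num (n x)) (.var 1))))
      (Proves.taut₂ (χ := fun x => Frm.imp (.mem (.var 1) (.upair (.num (n x)) (.num (n x))))
        (.eq (.num (n x)) (.var 1))) hmem₁ (hsymm.taut₂ hrefl
        (χ := fun x => Frm.imp (.eq (.var 1) (.num (n x))) (.eq (.num (n x)) (.var 1)))
        (by simp (maxDischargeDepth := 12) [hr]) ?_)
          (by simp (maxDischargeDepth := 12) [hr]) ?_) hrw
      (by simp (maxDischargeDepth := 12) [hr]) ?_).taut₂ (Proves.taut₂ (χ :=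
        fun x => Frm.imp (.mem (.num (n x)) (.var 1))
        (.exIn 2 (.upair (.num (n x)) (.num (n x))) (.mem (.var 2) (.var 1))))
        hmem hex (by simp (maxDischargeDepth := 12) [hr, Frm.exIn]) ?_)
          (by simp (maxDischargeDepth := 12) [hr, hsmall]) ?_
    all_goals
      intro x V hn hi
      simp only [Frm.and, hn, hi]
      tauto
  -- Generalization over `x_1`, moved past the premise `n ∈ n`, in which `x_1` is not free.
  have hall : F.Proves fun x => Frm.imp (.mem (.num (n x)) (.num (n x)))
      (.all 1 (.neg (.and (.mem (.var 1) (.upair (.num (n x)) (.num (n x))))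
        (.neg (.exIn 2 (.upair (.num (n x)) (.num (n x))) (.mem (.var 2) (.var 1))))))) := by
    refine Proves.taut₂ ((proves_logical (by simp (maxDischargeDepth := 12) [hr, hsmall])
      fun x => .distrib).mp
      (hmin.gen 1)) (proves_logical (φ := fun x => Frm.imp (.mem (.num (n x)) (.num (n x)))
        (.all 1 (.mem (.num (n x)) (.num (n x))))) (by simp (maxDischargeDepth := 12) [hr])
        fun x => .vacuous (by simp [Frm.Free])) (by simp (maxDischargeDepth := 12) [hr, hsmall])
          fun x V hn hi => ?_
    simp only [hi]
    tauto
  have hfound : F.Proves fun x => Frm.imp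
      (.ex 1 (.mem (.var 1) (.upair (.num (n x)) (.num (n x)))))
      (.ex 1 (.and (.mem (.var 1) (.upair (.num (n x)) (.num (n x))))
        (.neg (.exIn 2 (.upair (.num (n x)) (.num (n x))) (.mem (.var 2) (.var 1)))))) := by
    refine (proves_zfc .foundation).inst (r := fun x => .upair (.num (n x)) (.num (n x)))
      (by simp (maxDischargeDepth := 12) [hr]) (fun x => Frm.substitutable_of_closed
        (by simp [Trm.Occurs]) _ _) fun x => ?_
    simp [Frm.subst, Trm.subst, Frm.exIn, Frm.ex, Frm.and]
  have hne : F.Proves fun x => Frm.imp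
      (.mem (.num (n x)) (.upair (.num (n x)) (.num (n x))))
      (.ex 1 (.mem (.var 1) (.upair (.num (n x)) (.num (n x))))) := by
    refine proves_logical (by simp (maxDischargeDepth := 12) [hr]) fun x => ?_
    have := LogicalAxiom.exIntro (x := 1) (r := .num (n x))
      (α := .mem (.var 1) (.upair (.num (n x)) (.num (n x)))) (by simp)
    simpa [Frm.subst, Trm.subst] using this
  refine hall.taut₂ (hfound.mp (hne.mp hmem)) (by simp (maxDischargeDepth := 12) [hr])
    fun x V hn hi => ?_
  simp only [Frm.ex, hn, hi]
  tauto

/-- The smaller numeral is an element of the larger one, so equality would give `n ∈ n`. The two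
orders differ in which side of the membership is rewritten. -/
theorem proves_num_ne_num {m n : ι → ℕ} (hm : F.Small m) (hn : F.Small n) (h : ∀ x, m x ≠ n x) :
    F.Proves fun x => Frm.ne (.num (m x)) (.num (n x)) := by
  refine Proves.cases (fun x => m x < n x) ?_ ?_
  · have hm' := hm.comap (Subtype.val : {x // m x < n x} → ι)
    have hn' := hn.comap (Subtype.val : {x // m x < n x} → ι)
    refine (Proves.taut₂ (proves_num_not_mem_self hn')
      (proves_leibniz (s := fun y => .num (m y.1)) (u := fun y => .num (n y.1))
        (fun y => .mem (.var 100) (.num (n y.1))) (fun y => .mem (.var 101) (.num (n y.1)))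
        (tsmall_num hm') (tsmall_num hn') (by simp (maxDischargeDepth := 12) [hn'])
          (by simp (maxDischargeDepth := 12) [hn'])
        (fun _ => .mem_left .here) (by simp) (by simp)
        (fun y => by simp only [Frm.subst, Trm.subst, Trm.subst_num, if_true]; rfl)
        (fun y => by simp [Frm.subst, Trm.subst]; rfl)) ?_ ?_).mp
          (proves_num_mem_num hn' fun y => y.2)
    · simp (maxDischargeDepth := 12) [hm', hn', Frm.ne]
    · intro x V hn hi
      simp only [Frm.ne, hn, hi]
      tauto
  · have hm' := hm.comap (Subtype.val : {x // ¬ m x < n x} → ι)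
    have hn' := hn.comap (Subtype.val : {x // ¬ m x < n x} → ι)
    refine (Proves.taut₂ (proves_num_not_mem_self hn')
      (proves_leibniz (s := fun y => .num (m y.1)) (u := fun y => .num (n y.1))
        (fun y => .mem (.num (n y.1)) (.var 100)) (fun y => .mem (.num (n y.1)) (.var 101))
        (tsmall_num hm') (tsmall_num hn') (by simp (maxDischargeDepth := 12) [hn'])
          (by simp (maxDischargeDepth := 12) [hn'])
        (fun _ => .mem_right .here) (by simp) (by simp)
        (fun y => by simp only [Frm.subst, Trm.subst, Trm.subst_num, if_true]; rfl)
        (fun y => by simp [Frm.subst, Trm.subst]; rfl)) ?_ ?_).mp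
          (proves_num_mem_num (m := fun y => n y.1) hm' fun y => ?_)
    · simp (maxDischargeDepth := 12) [hm', hn', Frm.ne]
    · intro x V hn hi
      simp only [Frm.ne, hn, hi]
      tauto
    · have := h y.1
      have := y.2
      omega

end Family

/-! ## The formulas of the squares of the table -/

/-- The number that codes a tape symbol. -/
def Sym.idx : Sym → ℕ
  | .zero => 0
  | .one => 1
  | .blank => 2
  | .start => 3

theorem Sym.code_eq_num (a : Sym) : a.code = .num a.idx := by cases a <;> rfl

theorem Sym.idx_lt (a : Sym) : a.idx < 4 := by cases a <;> decide

/-- `t_{i,k} = (a, q, c)` -/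
def cellFrm (i k a q c : ℕ) : Frm :=
  .eq (cell (.num i) (.num k)) (square (.num a) (.num q) (.num c))

/-- `t_{i+1,k} = (π_M(t_{i,k}), p, c)` -/
def copiedFrm (i : ℕ) (k : Trm) (p c : ℕ) : Frm :=
  .eq (cell (.num (i + 1)) k) (square (projOf (cell (.num i) k)) (.num p) (.num c))

/-- The formula that describes square `k` of the configuration `c` in row `i`. -/
def rowFrm {M : TM} (i : ℕ) (c : Config M) (k : ℕ) : Frm :=
  cellFrm i k (c.tape k).idx c.state (if k = c.head then 1 else 0)

namespace Family

variable {ι κ : Type*} {F : Family ι}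

theorem Proves.comap {φ : ι → Frm} (h : F.Proves φ) (g : κ → ι) :
    (F.comap g).Proves fun y => φ (g y) := by
  obtain ⟨f, hf, h⟩ := h
  exact ⟨_, hf.comap g, fun y => h (g y)⟩

@[simp] theorem fsmall_cellFrm {i k a q c : ι → ℕ} (hi : F.Small i) (hk : F.Small k)
    (ha : F.Small a) (hq : F.Small q) (hc : F.Small c) :
    F.FSmall fun x => cellFrm (i x) (k x) (a x) (q x) (c x) :=
  fsmall_eq (tsmall_bin (tsmall_bin (tsmall_const _) (tsmall_num hi)) (tsmall_num hk))
    (tsmall_bin (tsmall_bin (tsmall_num ha) (tsmall_num hq)) (tsmall_num hc))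

theorem Small.of_lt {f : ι → ℕ} (N : ℕ) (h : ∀ x, f x < N) : F.Small f :=
  (small_const N).mono fun x => (h x).le

theorem small_idx (a : ι → Sym) : F.Small fun x => (a x).idx := .of_lt 4 fun x => (a x).idx_lt

theorem small_state {M : TM} (q : ι → Fin M.card) : F.Small fun x => (q x : ℕ) :=
  .of_lt M.card fun x => (q x).2

/-- Numerals are closed, so they are always substitutable; only membership in the bounding set has
to be supplied. -/
theorem Proves.inst_allIn {k : ℕ} {A : Trm} {n : ι → ℕ} {φ ψ : ι → Frm}
    (h : F.Proves fun x => Frm.allIn k A (φ x)) (hn : F.Small n) (hA : ∀ r, A.subst k r = A)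
    (hmem : F.Proves fun x => Frm.mem (.num (n x)) A)
    (he : ∀ x, (φ x).subst k (.num (n x)) = ψ x) : F.Proves ψ :=
  (Proves.inst (ψ := fun x => Frm.imp (.mem (.num (n x)) A) (ψ x)) h (tsmall_num hn) (by simp)
    fun x => by simp [Frm.subst, Trm.subst, hA, he]).mp hmem

theorem Proves.inst_omega₂ {i j : ι → ℕ} {φ ψ : ι → Frm}
    (h : F.Proves fun x => Frm.allIn 0 .omega (Frm.allIn 1 .omega (φ x)))
    (hi : F.Small i) (hj : F.Small j)
    (he : ∀ x, ((φ x).subst 0 (.num (i x))).subst 1 (.num (j x)) = ψ x) : F.Proves ψ :=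
  (h.inst_allIn (ψ := fun x => Frm.allIn 1 .omega ((φ x).subst 0 (.num (i x)))) hi
    (fun _ => rfl) (proves_num_mem_omega hi)
    fun x => by simp [Frm.allIn, Frm.subst, Trm.subst]).inst_allIn hj
    (fun _ => rfl) (proves_num_mem_omega hj) he

variable {M : TM}

theorem proves_defFormula {φ : ι → Frm} (hT : ∀ x, ∀ ψ ∈ M.defFormulas, ψ ∈ F.thy x)
    (h : ∀ x, φ x ∈ M.defFormulas) : F.Proves φ :=
  proves_hyp ((small_const (cost M.defFormulas)).mono fun x => sz_le_cost (h x))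
    fun x => hT x _ (h x)

theorem proves_transitionFormula (hT : ∀ x, ∀ ψ ∈ M.defFormulas, ψ ∈ F.thy x)
    {q p : ι → Fin M.card} {a b : ι → Sym} {d : Dir} (h : ∀ x, M.δ (q x) (a x) = (p x, b x, d)) :
    F.Proves fun x => M.transitionFormula (q x) (a x) (p x, b x, d) := by
  refine proves_defFormula hT fun x => ?_
  simp only [TM.defFormulas, TM.transitionFormulas, List.mem_append, List.mem_flatMap]
  refine .inl (.inr ⟨q x, List.mem_finRange _, ?_⟩)
  rw [← h x]
  cases a x <;> simp

/-- The three arguments lie below the numerals that code `Γ`, `Q` and `{0, 1}`, so the bounded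
quantifiers in the defining equation of `π_M` can be instantiated. -/
theorem proves_projOf (hT : ∀ x, ∀ ψ ∈ M.defFormulas, ψ ∈ F.thy x)
    {a q c : ι → ℕ} (ha : ∀ x, a x < 4) (hq : ∀ x, q x < M.card) (hc : ∀ x, c x < 2) :
    F.Proves fun x =>
      Frm.eq (projOf (square (.num (a x)) (.num (q x)) (.num (c x)))) (.num (a x)) := by
  have h : F.Proves fun _ => Frm.allIn 0 TM.gammaSet (Frm.allIn 1 M.stateSet
      (Frm.allIn 2 TM.bitSet (.eq (projOf (square (.var 0) (.var 1) (.var 2))) (.var 0)))) :=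
    proves_defFormula hT fun x => by simp [TM.defFormulas, TM.projFormulas]
  refine ((h.inst_allIn (n := a) (ψ := fun x => Frm.allIn 1 M.stateSet (Frm.allIn 2 TM.bitSet
    (.eq (projOf (square (.num (a x)) (.var 1) (.var 2))) (.num (a x))))) (.of_lt 4 ha)
    (fun r => Trm.subst_num _ _ _) (proves_num_mem_num (small_const 4) ha) ?_).inst_allIn
    (n := q) (ψ := fun x => Frm.allIn 2 TM.bitSet
    (.eq (projOf (square (.num (a x)) (.num (q x)) (.var 2))) (.num (a x)))) (.of_lt M.card hq)
    (fun r => Trm.subst_num _ _ _) (proves_num_mem_num (small_const M.card) hq) ?_).inst_allIn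
    (n := c) (.of_lt 2 hc)
    (fun r => Trm.subst_num _ _ _) (proves_num_mem_num (small_const 2) hc) ?_
  all_goals
    intro x
    simp [Frm.allIn, Frm.subst, Trm.subst, TM.stateSet, TM.bitSet, projOf, square]

/-- An unchanged square. -/
theorem Proves.cellFrm_of_copiedFrm (hT : ∀ x, ∀ ψ ∈ M.defFormulas, ψ ∈ F.thy x)
    {i k a q c p c' : ι → ℕ} (hi : F.Small i) (hk : F.Small k) (ha : ∀ x, a x < 4)
    (hq : ∀ x, q x < M.card) (hc : ∀ x, c x < 2) (hp : F.Small p) (hc' : F.Small c')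
    (h₁ : F.Proves fun x => copiedFrm (i x) (.num (k x)) (p x) (c' x))
    (h₂ : F.Proves fun x => cellFrm (i x) (k x) (a x) (q x) (c x)) :
    F.Proves fun x => cellFrm (i x + 1) (k x) (a x) (p x) (c' x) := by
  have hi' := tsmall_num hi
  have hi₁ := tsmall_num (hi.add (small_const 1))
  have hk' := tsmall_num hk
  have hp' := tsmall_num hp
  have hcs := tsmall_num hc'
  have ha' := tsmall_num (.of_lt 4 ha : F.Small a)
  have hq' := tsmall_num (.of_lt _ hq : F.Small q)
  have hc'' := tsmall_num (.of_lt 2 hc : F.Small c)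
  have hsq : F.TSmall fun x => square (.num (a x)) (.num (q x)) (.num (c x)) :=
    tsmall_bin (tsmall_bin ha' hq') hc''
  have hcell : F.TSmall fun x => cell (.num (i x)) (.num (k x)) :=
    tsmall_bin (tsmall_bin (tsmall_const _) hi') hk'
  have hcell₁ : F.TSmall fun x => cell (.num (i x + 1)) (.num (k x)) :=
    tsmall_bin (tsmall_bin (tsmall_const _) hi₁) hk'
  -- First the known value of the old square is inserted under `π_M`; the second rewriting evaluates
  -- `π_M` there.
  have hmid := ((proves_leibniz (s := fun x => cell (.num (i x)) (.num (k x)))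
    (u := fun x => square (.num (a x)) (.num (q x)) (.num (c x)))
    (fun x => Frm.eq (cell (.num (i x + 1)) (.num (k x)))
      (square (projOf (.var 100)) (.num (p x)) (.num (c' x))))
    (fun x => Frm.eq (cell (.num (i x + 1)) (.num (k x)))
      (square (projOf (.var 101)) (.num (p x)) (.num (c' x))))
    (α' := fun x => copiedFrm (i x) (.num (k x)) (p x) (c' x))
    (β' := fun x => Frm.eq (cell (.num (i x + 1)) (.num (k x)))
      (square (projOf (square (.num (a x)) (.num (q x)) (.num (c x)))) (.num (p x))
        (.num (c' x))))
    hcell hsq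
    (fsmall_eq hcell₁ (tsmall_bin (tsmall_bin (tsmall_const _) hp') hcs))
    (fsmall_eq hcell₁ (tsmall_bin (tsmall_bin (tsmall_const _) hp') hcs))
    (fun x => .eq_right (.left (.left (.right .here))))
    (fun x => by simp [cell, Trm.Occurs]) (fun x => by simp [cell, Trm.subst])
    (fun x => by simp [cell, square, projOf, copiedFrm, Trm.subst, Frm.subst])
    (fun x => by simp [cell, square, projOf, Trm.subst, Frm.subst])).mp h₂).mp h₁
  exact ((proves_leibniz
    (s := fun x => projOf (square (.num (a x)) (.num (q x)) (.num (c x))))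
    (u := fun x => .num (a x))
    (fun x => Frm.eq (cell (.num (i x + 1)) (.num (k x)))
      (square (.var 100) (.num (p x)) (.num (c' x))))
    (fun x => Frm.eq (cell (.num (i x + 1)) (.num (k x)))
      (square (.var 101) (.num (p x)) (.num (c' x))))
    (tsmall_bin (tsmall_const _) hsq) ha'
    (fsmall_eq hcell₁ (tsmall_bin (tsmall_bin (tsmall_const _) hp') hcs))
    (fsmall_eq hcell₁ (tsmall_bin (tsmall_bin (tsmall_const _) hp') hcs))
    (fun x => .eq_right (.left (.left .here)))
    (fun x => by simp [projOf, square, Trm.Occurs])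
    (fun x => by simp [projOf, square, Trm.subst])
    (fun x => by simp [cell, square, projOf, Trm.subst, Frm.subst])
    (fun x => by simp [cell, square, cellFrm, Trm.subst, Frm.subst])).mp
    (proves_projOf hT ha hq hc)).mp hmid

/-! ## Transitions -/

section Transition

variable {q p : ι → Fin M.card} {a b : ι → Sym} {i h k : ι → ℕ}

/-- The transition formula is instantiated at the current row and head position, and its premise is
detached using the known head square. -/
theorem proves_stay (hT : ∀ x, ∀ ψ ∈ M.defFormulas, ψ ∈ F.thy x)
    (hδ : ∀ x, M.δ (q x) (a x) = (p x, b x, .S)) (hi : F.Small i) (hh : F.Small h)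
    (hc : F.Proves fun x => cellFrm (i x) (h x) (a x).idx (q x) 1) :
    F.Proves fun x => Frm.and (cellFrm (i x + 1) (h x) (b x).idx (p x) 1)
      (Frm.allIn 2 .omega (.imp (Frm.ne (.var 2) (.num (h x)))
        (copiedFrm (i x) (.var 2) (p x) 0))) := by
  refine (Proves.inst_omega₂ (proves_transitionFormula hT hδ) hi hh fun x => ?_).mp hc
  simp [Frm.subst, Trm.subst, Frm.and, Frm.ne, Frm.allIn, TM.copied, copiedFrm, cellFrm, cell,
    square, projOf, TM.stateCode, Sym.code_eq_num, Trm.num]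

theorem proves_right (hT : ∀ x, ∀ ψ ∈ M.defFormulas, ψ ∈ F.thy x)
    (hδ : ∀ x, M.δ (q x) (a x) = (p x, b x, .R)) (hi : F.Small i) (hh : F.Small h)
    (hc : F.Proves fun x => cellFrm (i x) (h x) (a x).idx (q x) 1) :
    F.Proves fun x => Frm.and (cellFrm (i x + 1) (h x) (b x).idx (p x) 0)
      (Frm.and (copiedFrm (i x) (.num (h x + 1)) (p x) 1)
        (Frm.allIn 2 .omega (.imp
          (Frm.and (Frm.ne (.var 2) (.num (h x))) (Frm.ne (.var 2) (.num (h x + 1))))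
          (copiedFrm (i x) (.var 2) (p x) 0)))) := by
  refine (Proves.inst_omega₂ (proves_transitionFormula hT hδ) hi hh fun x => ?_).mp hc
  simp [Frm.subst, Trm.subst, Frm.and, Frm.ne, Frm.allIn, TM.copied, copiedFrm, cellFrm, cell,
    square, projOf, TM.stateCode, Sym.code_eq_num, Trm.num]

/-- Here `h` is the head position after the move, in accordance with the form of the transition
formula for left moves. -/
theorem proves_left (hT : ∀ x, ∀ ψ ∈ M.defFormulas, ψ ∈ F.thy x)
    (hδ : ∀ x, M.δ (q x) (a x) = (p x, b x, .L)) (hi : F.Small i) (hh : F.Small h)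
    (hc : F.Proves fun x => cellFrm (i x) (h x + 1) (a x).idx (q x) 1) :
    F.Proves fun x => Frm.and (cellFrm (i x + 1) (h x + 1) (b x).idx (p x) 0)
      (Frm.and (copiedFrm (i x) (.num (h x)) (p x) 1)
        (Frm.allIn 2 .omega (.imp
          (Frm.and (Frm.ne (.var 2) (.num (h x + 1))) (Frm.ne (.var 2) (.num (h x))))
          (copiedFrm (i x) (.var 2) (p x) 0)))) := by
  refine (Proves.inst_omega₂ (proves_transitionFormula hT hδ) hi hh fun x => ?_).mp hc
  simp [Frm.subst, Trm.subst, Frm.and, Frm.ne, Frm.allIn, TM.copied, copiedFrm, cellFrm, cell,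
    square, projOf, TM.stateCode, Sym.code_eq_num, Trm.num]

theorem Proves.copiedFrm_of_ne (hk : F.Small k) (hh : F.Small h)
    (hne : ∀ x, k x ≠ h x)
    (H : F.Proves fun x => Frm.allIn 2 .omega (.imp (Frm.ne (.var 2) (.num (h x)))
        (copiedFrm (i x) (.var 2) (p x) 0))) :
    F.Proves fun x => copiedFrm (i x) (.num (k x)) (p x) 0 := by
  refine (H.inst_allIn hk (fun _ => rfl) (proves_num_mem_omega hk) fun x => ?_).mp
    (proves_num_ne_num hk hh hne)
  simp [Frm.subst, Trm.subst, Frm.ne, copiedFrm, cell, square, projOf]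

theorem Proves.copiedFrm_of_ne_of_ne {h' : ι → ℕ} (hk : F.Small k)
    (hh : F.Small h) (hh' : F.Small h') (hne : ∀ x, k x ≠ h x) (hne' : ∀ x, k x ≠ h' x)
    (H : F.Proves fun x => Frm.allIn 2 .omega (.imp
      (Frm.and (Frm.ne (.var 2) (.num (h x))) (Frm.ne (.var 2) (.num (h' x))))
      (copiedFrm (i x) (.var 2) (p x) 0))) :
    F.Proves fun x => copiedFrm (i x) (.num (k x)) (p x) 0 := by
  have h₁ := proves_num_ne_num hk hh hne
  have h₂ := proves_num_ne_num hk hh' hne'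
  refine (H.inst_allIn hk (fun _ => rfl) (proves_num_mem_omega hk) fun x => ?_).mp
    (h₁.taut₂ h₂ (fsmall_and h₁.fsmall h₂.fsmall) fun x V hn hi => ?_)
  · simp [Frm.subst, Trm.subst, Frm.ne, Frm.and, copiedFrm, cell, square, projOf]
  · simp only [Frm.and, hn, hi]
    tauto

end Transition

theorem Proves.and_left {φ ψ : ι → Frm} (h : F.Proves fun x => Frm.and (φ x) (ψ x)) :
    F.Proves φ :=
  h.taut₁ (h.fsmall.mono fun x => by simp only [Frm.and, Frm.sz]; omega) fun x V hn hi => by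
    simp only [Frm.and, hn, hi]
    tauto

theorem Proves.and_right {φ ψ : ι → Frm} (h : F.Proves fun x => Frm.and (φ x) (ψ x)) :
    F.Proves ψ :=
  h.taut₁ (h.fsmall.mono fun x => by simp only [Frm.and, Frm.sz]; omega) fun x V hn hi => by
    simp only [Frm.and, hn, hi]
    tauto

theorem Proves.congr {φ ψ : ι → Frm} (h : F.Proves φ) (he : ∀ x, φ x = ψ x) : F.Proves ψ :=
  funext he ▸ h

end Family

/-! ### One step of the machine, and the initial row -/

namespace Family

variable {ι : Type*} {F : Family ι} {M : TM}

section Step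

variable {c : ι → Config M} {i k : ι → ℕ}

/-- A step rewrites only the symbol under the head; every other square keeps its symbol and needs
just the new state and head bit. This isolates what each direction has to provide. -/
theorem Proves.rowFrm_step_of (hT : ∀ x, ∀ ψ ∈ M.defFormulas, ψ ∈ F.thy x) (hi : F.Small i)
    (hk : F.Small k) (hrow : F.Proves fun x => rowFrm (i x) (c x) (k x))
    (hhead : F.Proves fun x => cellFrm (i x + 1) (c x).head ((M.step (c x)).tape (c x).head).idx
      (M.step (c x)).state (if (c x).head = (M.step (c x)).head then 1 else 0))
    (hcopy : (F.comap (Subtype.val : {x // ¬ k x = (c x).head} → ι)).Proves fun y =>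
      copiedFrm (i y.1) (.num (k y.1)) (M.step (c y.1)).state
        (if k y.1 = (M.step (c y.1)).head then 1 else 0)) :
    F.Proves fun x => rowFrm (i x + 1) (M.step (c x)) (k x) := by
  refine Proves.cases (fun x => k x = (c x).head) ?_ ?_
  · refine (hhead.comap _).congr fun y => ?_
    rw [rowFrm, y.2]
  · refine (hcopy.cellFrm_of_copiedFrm (fun y => hT y.1) (hi.comap _) (hk.comap _)
      (fun y => Sym.idx_lt _) (fun y => Fin.is_lt _) (fun y => ?_) (small_state _)
      (.of_lt 2 fun y => ?_) (hrow.comap _)).congr fun y => ?_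
    · split_ifs <;> decide
    · split_ifs <;> decide
    · have : (M.step (c y.1)).tape (k y.1) = (c y.1).tape (k y.1) := Function.update_of_ne y.2 _ _
      rw [rowFrm, this]

theorem Proves.rowFrm_step_of_dir (hT : ∀ x, ∀ ψ ∈ M.defFormulas, ψ ∈ F.thy x)
    (hi : F.Small i) (hk : F.Small k) (hh : F.Small fun x => (c x).head)
    (hhd : F.Proves fun x => rowFrm (i x) (c x) (c x).head)
    (hrow : F.Proves fun x => rowFrm (i x) (c x) (k x)) (d : Dir)
    (hd : ∀ x, (M.δ (c x).state ((c x).tape (c x).head)).2.2 = d)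
    (hL : d = .L → ∀ x, 0 < (c x).head) :
    F.Proves fun x => rowFrm (i x + 1) (M.step (c x)) (k x) := by
  have hδ : ∀ x, M.δ (c x).state ((c x).tape (c x).head) =
      ((M.step (c x)).state, (M.step (c x)).tape (c x).head, d) := fun x => by
    simp [TM.step, ← hd x]
  have hmove : ∀ x, (M.step (c x)).head = TM.move d (c x).head := fun x => by
    simp [TM.step, hd x]
  have hcell : F.Proves fun x => cellFrm (i x) (c x).head ((c x).tape (c x).head).idx
      (c x).state 1 := hhd.congr fun x => by simp [rowFrm]
  cases d with
  | S =>
    have H := proves_stay hT hδ hi hh hcell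
    refine hrow.rowFrm_step_of hT hi hk (H.and_left.congr fun x => ?_)
      (((H.and_right.comap _).copiedFrm_of_ne (hk.comap _) (hh.comap _) fun y => y.2).congr
        fun y => ?_)
    · simp [hmove, TM.move]
    · have := y.2
      simp [hmove, TM.move, this]
  | R =>
    have H := proves_right hT hδ hi hh hcell
    refine hrow.rowFrm_step_of hT hi hk (H.and_left.congr fun x => ?_)
      (Proves.cases (fun y => k y.1 = (c y.1).head + 1) ?_ ?_)
    · simp [hmove, TM.move]
    · refine ((H.and_right.and_left.comap _).comap _).congr fun y => ?_
      have := y.2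
      simp [hmove, TM.move, this]
    · refine (((H.and_right.and_right.comap _).comap _).copiedFrm_of_ne_of_ne
        ((hk.comap _).comap _) ((hh.comap _).comap _)
        (((hh.add (small_const 1)).comap _).comap _) (fun y => y.1.2) fun y => y.2).congr
        fun y => ?_
      have := y.2
      simp [hmove, TM.move, this]
  | L =>
    -- Since the head is not on square `0`, the truncated subtraction is a genuine predecessor.
    have hpos : ∀ x, (c x).head - 1 + 1 = (c x).head := fun x => Nat.sub_add_cancel (hL rfl x)
    have hh' : F.Small fun x => (c x).head - 1 := hh.mono fun x => Nat.sub_le _ _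
    have H := proves_left hT hδ hi hh' (hcell.congr fun x => by rw [hpos])
    refine hrow.rowFrm_step_of hT hi hk (H.and_left.congr fun x => ?_)
      (Proves.cases (fun y => k y.1 = (c y.1).head - 1) ?_ ?_)
    · have := hpos x
      have : (c x).head ≠ (c x).head - 1 := by omega
      simp only [hpos, hmove, TM.move, if_neg this]
    · refine ((H.and_right.and_left.comap _).comap _).congr fun y => ?_
      have := y.2
      simp [hmove, TM.move, this]
    · refine (((H.and_right.and_right.comap _).comap _).copiedFrm_of_ne_of_ne
        ((hk.comap _).comap _) (((hh'.add (small_const 1)).comap _).comap _)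
        ((hh'.comap _).comap _) (fun y => ?_) fun y => y.2).congr
        fun y => ?_
      · rw [hpos]
        exact y.1.2
      · have := y.2
        simp [hmove, TM.move, this]

theorem Proves.rowFrm_step (hT : ∀ x, ∀ ψ ∈ M.defFormulas, ψ ∈ F.thy x)
    (hi : F.Small i) (hk : F.Small k) (hh : F.Small fun x => (c x).head)
    (hhd : F.Proves fun x => rowFrm (i x) (c x) (c x).head)
    (hrow : F.Proves fun x => rowFrm (i x) (c x) (k x))
    (hL : ∀ x, (M.δ (c x).state ((c x).tape (c x).head)).2.2 = .L → 0 < (c x).head) :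
    F.Proves fun x => rowFrm (i x + 1) (M.step (c x)) (k x) := by
  refine Proves.cases (fun x => (M.δ (c x).state ((c x).tape (c x).head)).2.2 = .L) ?_
    (Proves.cases (fun y => (M.δ (c y.1).state ((c y.1).tape (c y.1).head)).2.2 = .S) ?_ ?_)
  · exact (hhd.comap _).rowFrm_step_of_dir (fun y => hT y.1) (hi.comap _) (hk.comap _)
      (hh.comap _) (hrow.comap _) .L (fun y => y.2) fun _ y => hL y.1 y.2
  · exact ((hhd.comap _).comap _).rowFrm_step_of_dir (fun y => hT y.1.1)
      ((hi.comap _).comap _) ((hk.comap _).comap _) ((hh.comap _).comap _)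
      ((hrow.comap _).comap _) .S (fun y => y.2) nofun
  · exact ((hhd.comap _).comap _).rowFrm_step_of_dir (fun y => hT y.1.1)
      ((hi.comap _).comap _) ((hk.comap _).comap _) ((hh.comap _).comap _)
      ((hrow.comap _).comap _) .R (fun y => by
        have h₁ := y.1.2
        have h₂ := y.2
        cases h : (M.δ (c y.1.1).state ((c y.1.1).tape (c y.1.1).head)).2.2 <;> simp_all) nofun

end Step

/-- Up to square `‖s‖` the formula is literally a member of the theory. Beyond it, the blank formula
is instantiated, with `‖s‖ ∈ k` as its premise. -/
theorem proves_rowFrm_init {s : ι → List Bool} {k : ι → ℕ}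
    (hT : ∀ x, ∀ ψ ∈ M.inputFormulas (s x), ψ ∈ F.thy x) (hs : F.Small fun x => (s x).length)
    (hk : F.Small k) : F.Proves fun x => rowFrm 0 (M.init (s x)) (k x) := by
  refine Proves.cases (fun x => k x ≤ (s x).length) ?_ ?_
  · refine proves_hyp (fsmall_cellFrm (small_const 0) (hk.comap _) (small_idx _) (small_state _)
      (.of_lt 2 fun y => by split_ifs <;> decide)) fun y => hT y.1 _ ?_
    cases hky : k y.1 with
    | zero =>
      simp [TM.inputFormulas, rowFrm, cellFrm, TM.init, Sym.code_eq_num, TM.stateCode]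
    | succ j =>
      have hj : j < (s y.1).length := by
        have := y.2
        omega
      refine List.mem_append_right _ (List.mem_map.2 ⟨⟨j, hj⟩, List.mem_finRange _, ?_⟩)
      simp [rowFrm, cellFrm, TM.init, Sym.code_eq_num, TM.stateCode, hj]
  · have hs' := hs.comap (Subtype.val : {x // ¬ k x ≤ (s x).length} → ι)
    have hk' := hk.comap (Subtype.val : {x // ¬ k x ≤ (s x).length} → ι)
    have h : (F.comap (Subtype.val : {x // ¬ k x ≤ (s x).length} → ι)).Proves fun y =>
        Frm.allIn 1 .omega (.imp (.mem (.num (s y.1).length) (.var 1))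
          (.eq (cell (.num 0) (.var 1)) M.blankSquare)) :=
      proves_hyp (fsmall_all (fsmall_imp (fsmall_const _)
        (fsmall_imp (fsmall_mem (tsmall_num hs') (tsmall_const _)) (fsmall_const _))))
        fun y => hT y.1 _ (by simp [TM.inputFormulas])
    refine ((h.inst_allIn (ψ := fun y => Frm.imp (.mem (.num (s y.1).length) (.num (k y.1)))
      (.eq (cell (.num 0) (.num (k y.1))) M.blankSquare)) hk' (fun _ => rfl)
      (proves_num_mem_omega hk') fun y => ?_).mp
      (proves_num_mem_num hk' fun y => not_le.1 y.2)).congr fun y => ?_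
    · simp [Frm.subst, Trm.subst, cell, TM.blankSquare, square, Sym.code_eq_num, TM.stateCode]
    · have hy := y.2
      obtain ⟨j, hj⟩ : ∃ j, k y.1 = j + 1 := ⟨k y.1 - 1, by omega⟩
      have : (s y.1)[j]? = none := List.getElem?_eq_none (by omega)
      simp [rowFrm, cellFrm, TM.init, Sym.code_eq_num, TM.stateCode, TM.blankSquare, hj, this]

end Family

/-! ## Computations -/

namespace TM

variable {M : TM}

theorem run_succ (s : List Bool) (i : ℕ) : M.run s (i + 1) = M.step (M.run s i) :=
  Function.iterate_succ_apply' _ _ _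

theorem head_run_le (s : List Bool) (i : ℕ) : (M.run s i).head ≤ i := by
  induction i with
  | zero => rfl
  | succ i ih =>
    rw [run_succ]
    simp only [step]
    cases (M.δ (M.run s i).state ((M.run s i).tape (M.run s i).head)).2.2 <;>
      simp only [move] <;> omega

/-- The marker survives because square `0` changes only while the head reads it, and then both the
halting rule and the rule for `▷` keep it. -/
theorem tape_run_zero (s : List Bool) (i : ℕ) : (M.run s i).tape 0 = .start := by
  induction i with
  | zero => rfl
  | succ i ih =>
    rw [run_succ]
    simp only [step, Function.update_apply]
    split_ifs with h
    · rw [← h, ih]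
      by_cases hq : (M.run s i).state = M.halt
      · rw [hq, M.halt_rule]
      · rw [M.start_rule _ hq]
    · exact ih

/-- On square `0` the head reads `▷`, and then it stays or moves right. -/
theorem head_pos_of_left (s : List Bool) (i : ℕ)
    (h : (M.δ (M.run s i).state ((M.run s i).tape (M.run s i).head)).2.2 = .L) :
    0 < (M.run s i).head := by
  by_contra h0
  rw [Nat.eq_zero_of_not_pos h0, tape_run_zero] at h
  by_cases hq : (M.run s i).state = M.halt
  · rw [hq, M.halt_rule] at h
    cases h
  · rw [M.start_rule _ hq] at h
    cases h

theorem step_of_halt {c : Config M} (h : c.state = M.halt) : M.step c = c := by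
  obtain ⟨q, n, t⟩ := c
  subst h
  simp [step, M.halt_rule, move]

theorem run_add_of_halt {s : List Bool} {i : ℕ} (h : (M.run s i).state = M.halt) (j : ℕ) :
    M.run s (i + j) = M.run s i := by
  induction j with
  | zero => rfl
  | succ j ih => rw [← add_assoc, run_succ, ih, step_of_halt h]

theorem exists_halt_le {s : List Bool} {N : ℕ} (h : M.steps s ≤ N) :
    ∃ i ≤ N, (M.run s i).state = M.halt := by
  by_contra! hn
  have : ((N + 1 : ℕ) : ℕ∞) ≤ M.steps s := le_iInf fun i => le_iInf fun hi => by
    have : ¬ i ≤ N := fun hiN => hn i hiN hi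
    exact_mod_cast (show N + 1 ≤ i by omega)
  have := this.trans h
  norm_cast at this
  omega

/-- A machine with output `v` reaches it within its running time. -/
theorem Outputs.exists_le {s : List Bool} {v : Bool} {N : ℕ} (h : M.Outputs s v)
    (hN : M.steps s ≤ N) : ∃ i ≤ N, (M.run s i).state = M.halt ∧ (M.run s i).head = 1 ∧
      (M.run s i).tape 1 = bitSym v := by
  obtain ⟨i, hi⟩ := h
  obtain ⟨j, hj, hjh⟩ := exists_halt_le hN
  rcases le_total i j with hij | hij
  · exact ⟨i, hij.trans hj, hi⟩
  -- Configurations are constant after halting, so the output is already visible at time `j`.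
  · obtain ⟨d, rfl⟩ := Nat.exists_eq_add_of_le hij
    rw [run_add_of_halt hjh] at hi
    exact ⟨j, hj, hi⟩

end TM

open Family in
/-- Computations of polynomial length have proofs of polynomial size. -/
theorem Family.proves_goal {ι : Type*} {F : Family ι} {M : TM} {s : ι → List Bool} {v : ι → Bool}
    {f : ι → ℕ} (hT : ∀ x, ∀ ψ ∈ M.theory (s x), ψ ∈ F.thy x)
    (hs : F.Small fun x => (s x).length) (hf : F.Small f)
    (hout : ∀ x, (M.run (s x) (f x)).state = M.halt ∧ (M.run (s x) (f x)).head = 1 ∧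
      (M.run (s x) (f x)).tape 1 = bitSym (v x)) : F.Proves fun x => M.goal (v x) := by
  have hdef : ∀ x, ∀ ψ ∈ M.defFormulas, ψ ∈ F.thy x := fun x ψ hψ =>
    hT x ψ (List.mem_append_left _ hψ)
  have hinp : ∀ x, ∀ ψ ∈ M.inputFormulas (s x), ψ ∈ F.thy x := fun x ψ hψ =>
    hT x ψ (List.mem_append_right _ hψ)
  -- The width exceeds every head position up to time `f` and includes square `1` even if `f = 0`.
  have hw : F.Small fun x => f x + 2 := hf.add (small_const 2)
  have hrow : F.Proves fun x => rowFrm (f x) (M.run (s x) (f x)) 1 := by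
    refine proves_of_rows (φ := fun x j k => rowFrm j (M.run (s x) j) k) (k₀ := fun _ => 1)
      hf hw ?_ ?_ (by simp)
    · exact proves_rowFrm_init (fun y => hinp y.1.1) (hs.comap _)
        ((hw.comap _).mono fun y => y.2.le)
    · have hj := ((hf.comap fun y : {p : ι × ℕ × ℕ // p.2.1 < f p.1 ∧ p.2.2 < f p.1 + 2} =>
        y.1.1).mono fun y => y.2.1.le).adjoin fun y => {ψ | ∃ k < f y.1.1 + 2,
          ψ = rowFrm y.1.2.1 (M.run (s y.1.1) y.1.2.1) k}
      have hk := ((hw.comap fun y : {p : ι × ℕ × ℕ // p.2.1 < f p.1 ∧ p.2.2 < f p.1 + 2} =>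
        y.1.1).mono fun y => y.2.2.le).adjoin fun y => {ψ | ∃ k < f y.1.1 + 2,
          ψ = rowFrm y.1.2.1 (M.run (s y.1.1) y.1.2.1) k}
      have hh := hj.mono fun y => TM.head_run_le (M := M) (s y.1.1) y.1.2.1
      refine (Proves.rowFrm_step ?_ hj hk hh ?_ ?_
        fun y => TM.head_pos_of_left _ _).congr fun y => by rw [TM.run_succ]
      · exact fun y ψ hψ => .inl (hdef y.1.1 ψ hψ)
      -- The head square belongs to the previous row as far as it was derived, since the head
      -- position is at most `j`, and `j < f`.
      · refine proves_hyp (fsmall_cellFrm hj hh (small_idx _) (small_state _)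
          (.of_lt 2 fun y => by split_ifs <;> decide)) fun y => .inr ⟨_, ?_, rfl⟩
        have h₁ := TM.head_run_le (M := M) (s y.1.1) y.1.2.1
        have h₂ := y.2.1
        omega
      · exact proves_hyp (fsmall_cellFrm hj hk (small_idx _) (small_state _)
          (.of_lt 2 fun y => by split_ifs <;> decide)) fun y => .inr ⟨_, y.2.2, rfl⟩
  have hom := proves_num_mem_omega hf
  have hand : F.Proves fun x => Frm.and (.mem (.num (f x)) .omega)
      (rowFrm (f x) (M.run (s x) (f x)) 1) :=
    hom.taut₂ hrow (fsmall_and hom.fsmall hrow.fsmall) fun x V hn hi => by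
      simp only [Frm.and, hn, hi]
      tauto
  -- There are only two possible goals, so the sum of their sizes is a constant bound.
  have hgoal : F.FSmall fun x => M.goal (v x) := by
    have h : ∀ b, (M.goal b).sz ≤ (M.goal true).sz + (M.goal false).sz := fun b => by
      cases b
      exacts [Nat.le_add_left _ _, Nat.le_add_right _ _]
    exact Small.mono (small_const _) fun x => h (v x)
  refine (proves_logical (fsmall_imp hand.fsmall hgoal) fun x => ?_).mp hand
  obtain ⟨h₁, h₂, h₃⟩ := hout x
  have := LogicalAxiom.exIntro (x := 0) (r := .num (f x)) (α := Frm.and (.mem (.var 0) .omega)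
    (.eq (cell (.var 0) (.num 1)) (square (bitSym (v x)).code (M.stateCode M.halt) (.num 1))))
    (by simp)
  simpa [TM.goal, Frm.exIn, rowFrm, cellFrm, h₁, h₂, h₃, Frm.subst, Trm.subst, Frm.and, cell,
    square, Sym.code_eq_num, TM.stateCode] using this

end ProofComplexity

theorem mainTheorem3 (M : ProofComplexity.TM)
    (hval : ∀ s : List Bool, ∃ v : Bool, M.Outputs s v)
    (hpoly : M.IsPolyTime) :
    ∃ P : Polynomial ℕ, ∀ n : ℕ, M.apf n ≤ ((P.eval n : ℕ) : ℕ∞) := by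
  open ProofComplexity in
  obtain ⟨P, hP⟩ := hpoly
  have hex : ∀ x : {p : List Bool × Bool // M.Outputs p.1 p.2}, ∃ i ≤ P.eval x.1.1.length,
      (M.run x.1.1 i).state = M.halt ∧ (M.run x.1.1 i).head = 1 ∧
        (M.run x.1.1 i).tape 1 = bitSym x.1.2 := fun x =>
    x.2.exists_le ((le_iSup₂ (f := fun (s : List Bool) (_ : s.length = x.1.1.length) => M.steps s)
      x.1.1 rfl).trans (hP _))
  choose f hf hout using hex
  -- All inputs with their values form a single family, measured by input length, so one polynomial
  -- serves every input.
  let F : Family {p : List Bool × Bool // M.Outputs p.1 p.2} :=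
    ⟨fun x => x.1.1.length, fun x => {ψ | ψ ∈ M.theory x.1.1}⟩
  obtain ⟨g, ⟨Q, hQ⟩, hg⟩ := Family.proves_goal (F := F) (s := fun x => x.1.1) (f := f)
    (fun x ψ hψ => hψ) Family.small_size ⟨P, hf⟩ hout
  refine ⟨Q, fun n => iSup₂_le fun r hr => iSup₂_le fun v hv => ?_⟩
  obtain ⟨π, hπ, hm, hc⟩ := hg ⟨(r, v), hv⟩
  -- Truncation makes the goal the last formula; reversing the list then gives a normal proof.
  obtain ⟨ρ, hρ, hcρ⟩ := hπ.suffix hm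
  refine (iInf₂_le (f := fun π (_ : M.IsNormalProof r v π) => (seqLen π : ℕ∞))
    _ hρ.isProof).trans ?_
  have := hQ ⟨(r, v), hv⟩
  subst hr
  exact_mod_cast (seqLen_reverse_le_cost _).trans (hcρ.trans (hc.trans this))
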